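/- Let $\mathbb{Y}$ be a set, let $\theta \ge 0$, and for each $y \in \mathbb{Y}$ let $d_y \colon (\mathbb{Y}\setminus\{y\}) \times (\mathbb{Y}\setminus\{y\}) \to \mathbb{R}_{\ge 0}$ be a function such that, whenever the terms are defined: $d_y(x,z)=d_y(z,x)$; $d_y(x,w) \le d_y(x,z)+d_y(z,w)$; $\min\{d_y(x,z), d_z(x,y)\} \le \theta$ for distinct $x,y,z$; and $\{y \mid d_y(x,z) > \theta\}$ is finite for all $x,z$ (the projection complex axioms). For $x \ne z$ let $\mathcal{H}(x,z)$ be the set of pairs $(x',z')$ with $x' \neq z'$ such that one of the following holds: $d_x(x',z') > 2\theta$ and $d_z(x',z') > 2\theta$; $x'=x$ and $d_z(x,z')>2\theta$; $z'=z$ and $d_x(x',z)>2\theta$; $(x',z')=(x,z)$. For $x \ne z$ and $y \notin \{x,z\}$ put $$d'_y(x,z) = \inf\{ d_y(x',z') \mid (x',z') \in \mathcal{H}(x,z),\ x' \ne y \ne z'\}.$$ For $K \ge 0$ let $\mathcal{P}=\mathcal{P}_K(\mathbb{Y})$ be the graph with vertex set $\mathbb{Y}$ in which distinct $x,z$ are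 joined by an edge when $d'_y(x,z) \le K$ for all $y \notin \{x,z\}$; edges have length one. A group $G$ acts on $\mathcal{P}$ if it acts on $\mathbb{Y}$ with $d_{gy}(gx,gz)=d_y(x,z)$ whenever $x \ne y \ne z$. For $L>0$, an equivariant $L$-spinning family is a family of subgroups $R_v \le \mathrm{Stab}_G(v)$, $v \in \mathbb{Y}$, such that $gR_vg^{-1}=R_{gv}$ for all $g \in G$ and all $v$, and $d_v(w,hw) \ge L$ for all $v \ne w$ and all nontrivial $h \in R_v$. Let $\langle R_v\rangle$ be the subgroup of $G$ generated by all the $R_v$. **Theorem.** For every $\theta \ge 0$ there is a constant $K_0(\theta)$ such that the following holds for every $\mathbb{Y}$ and $\{d_y\}$ satisfying the projection complex axioms with constant $\theta$, and every $K \ge K_0(\theta)$. There are constants $L_{\rm hyp}(\mathcal{P})$ and $\delta(\mathcal{P})$, depending on $\mathcal{P}=\mathcal{P}_K(\mathbb{Y})$ but not on any group acting on it, such that for every group $G$ acting on $\mathcal{P}$, every $L \ge L_{\rm hyp}(\mathcal{P})$ and every equivariant $L$-spinning family $\{R_v\}$ of subgroups of $G$, the quotient graph $\mathcal{P}/\langle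 R_v\rangle$ is $\delta$-hyperbolic: it is connected, and for every triangle of geodesic edge paths between three of its vertices, each vertex on one side is at distance at most $\delta$ from some vertex on one of the other two sides. (For $\mathbb{Y}=\emptyset$ this is vacuous.) -/

import Mathlib

/-- The projection complex axioms, with constant `θ`, for a set `Y` with a function
`d y : (Y ∖ {y}) × (Y ∖ {y}) → ℝ≥0` for each `y : Y`. Here `d y x z` stands for `d_y(x, z)`;
it is a total function, but only its values at `x ≠ y` and `z ≠ y` are ever used. -/
structure ProjectionAxioms {Y : Type*} (θ : ℝ) (d : Y → Y → Y → ℝ) : Prop where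
  theta_nonneg : 0 ≤ θ
  nonneg : ∀ y x z, x ≠ y → z ≠ y → 0 ≤ d y x z
  symm : ∀ y x z, x ≠ y → z ≠ y → d y x z = d y z x
  triangle : ∀ y x z w, x ≠ y → z ≠ y → w ≠ y → d y x w ≤ d y x z + d y z w
  triples : ∀ x y z, x ≠ y → y ≠ z → x ≠ z → min (d y x z) (d z x y) ≤ θ
  finiteness : ∀ x z, {y | x ≠ y ∧ z ≠ y ∧ θ < d y x z}.Finite

/-- The set `𝓗(x, z)` of Bestvina, Bromberg and Fujiwara, for `x ≠ z`: the pairs `(x', z')` with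
`x' ≠ z'` such that `d_x(x', z'), d_z(x', z') > 2θ`, or `x' = x` and `d_z(x, z') > 2θ`, or
`z' = z` and `d_x(x', z) > 2θ`, or `(x', z') = (x, z)`. The inequations in each clause only say
that the distances in it are defined. -/
def modifyingPairs {Y : Type*} (θ : ℝ) (d : Y → Y → Y → ℝ) (x z : Y) : Set (Y × Y) :=
  {p | p.1 ≠ p.2 ∧
    ((p.1 ≠ x ∧ p.1 ≠ z ∧ p.2 ≠ x ∧ p.2 ≠ z ∧ 2 * θ < d x p.1 p.2 ∧ 2 * θ < d z p.1 p.2) ∨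
     (p.1 = x ∧ p.2 ≠ z ∧ 2 * θ < d z x p.2) ∨
     (p.2 = z ∧ p.1 ≠ x ∧ 2 * θ < d x p.1 z) ∨
     p = (x, z))}

/-- The modified distance `d'_y(x, z)` of Bestvina, Bromberg and Fujiwara, for `x, z ≠ y` and
`x ≠ z`: the infimum of `d_y(x', z')` over the pairs `(x', z')` in `𝓗(x, z)` at which `d_y` is
defined. One of these pairs is `(x, z)`, and `d_y ≥ 0`, so that it is a genuine infimum. -/
noncomputable def modifiedDist {Y : Type*} (θ : ℝ) (d : Y → Y → Y → ℝ) (y x z : Y) : ℝ :=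
  sInf {r | ∃ p ∈ modifyingPairs θ d x z, p.1 ≠ y ∧ p.2 ≠ y ∧ r = d y p.1 p.2}

/-- The graph `P_K(Y)`: distinct `x` and `z` are joined by an edge when `d'_y(x, z) ≤ K` for all
`y` other than `x` and `z`. (The modified distance is symmetric in `x` and `z` when `d` is; the
condition is symmetrized to have a graph for any `d`.) -/
def projectionComplex {Y : Type*} (θ : ℝ) (d : Y → Y → Y → ℝ) (K : ℝ) : SimpleGraph Y where
  Adj x z := x ≠ z ∧
    ∀ y, y ≠ x → y ≠ z → modifiedDist θ d y x z ≤ K ∧ modifiedDist θ d y z x ≤ K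
  symm := ⟨fun _ _ h => ⟨h.1.symm, fun y hx hz => (h.2 y hz hx).symm⟩⟩
  loopless := ⟨fun _ h => h.1 rfl⟩

/-- `G` acts on the projection complex: the action on the vertex set leaves the functions `d_y`
invariant, that is, `d_{gy}(gx, gz) = d_y(x, z)`. -/
def ActsOnProjectionComplex (G : Type*) {Y : Type*} [Group G] [MulAction G Y]
    (d : Y → Y → Y → ℝ) : Prop :=
  ∀ (g : G) (y x z : Y), x ≠ y → z ≠ y → d (g • y) (g • x) (g • z) = d y x z

/-- `{R_v}` is an equivariant `L`-spinning family of subgroups of `G`. -/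
structure IsEquivariantSpinningFamily {G Y : Type*} [Group G] [MulAction G Y]
    (d : Y → Y → Y → ℝ) (L : ℝ) (R : Y → Subgroup G) : Prop where
  pos : 0 < L
  le_stabilizer : ∀ v, R v ≤ MulAction.stabilizer G v
  equivariance : ∀ (g : G) (v : Y), (R v).map (MulAut.conj g).toMonoidHom = R (g • v)
  spinning : ∀ v w, v ≠ w → ∀ h ∈ R v, h ≠ 1 → L ≤ d v w (h • w)

/-- The quotient of a graph by a group acting on its vertices: the vertices are the orbits, and two
distinct orbits are joined when some edge of the graph joins a point of one to a point of the
other. (Loops and multiple edges of the quotient are dropped: they affect neither the path metric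
on the vertices nor the vertices that a geodesic visits.) -/
def quotientGraph {Y : Type*} (X : SimpleGraph Y) (H : Type*) [Group H] [MulAction H Y] :
    SimpleGraph (MulAction.orbitRel.Quotient H Y) where
  Adj a b := a ≠ b ∧ ∃ x y : Y, X.Adj x y ∧
    (Quotient.mk'' x : MulAction.orbitRel.Quotient H Y) = a ∧
    (Quotient.mk'' y : MulAction.orbitRel.Quotient H Y) = b
  symm := ⟨fun _ _ ⟨hne, x, y, h, hx, hy⟩ => ⟨hne.symm, y, x, h.symm, hy, hx⟩⟩
  loopless := ⟨fun _ h => h.1 rfl⟩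

/-- A walk is geodesic when its length is the distance of its endpoints in the path metric. -/
def IsGeodesicWalk {V : Type*} (X : SimpleGraph V) {u v : V} (p : X.Walk u v) : Prop :=
  p.length = X.dist u v

/-- A graph, with edges of length one, is `δ`-hyperbolic: it is connected (or empty), and every
geodesic triangle is `δ`-thin, that is, each side lies in the `δ`-neighborhood of the union of the
other two. By the cyclic symmetry of the condition it is enough to state it for the first side. -/
structure IsHyperbolicGraph {V : Type*} (X : SimpleGraph V) (δ : ℝ) : Prop where
  preconnected : X.Preconnected
  thin : ∀ (a b c : V) (p : X.Walk a b) (q : X.Walk b c) (r : X.Walk c a),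
    IsGeodesicWalk X p → IsGeodesicWalk X q → IsGeodesicWalk X r →
    ∀ u ∈ p.support, ∃ v, (v ∈ q.support ∨ v ∈ r.support) ∧ (X.dist u v : ℝ) ≤ δ

/-!
# Hyperbolicity of quotients of projection complexes

Let `X` be the projection complex, for `K ≥ 100θ + 100`. The modified distance agrees with the
original one up to `2θ` (`le_modifiedDist`) and is monotone (`modifiedDist_mono_left`). Hence two
vertices `x`, `z` are joined by a walk whose interior vertices `u` all have `d_u(x, z) > K`
(`exists_walk`), and the second vertex of this walk is a barrier next to `x`. Barriers show that a
path escaping from a vertex `v` at a linear rate has a projection to `v` of at most `2θ`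
(`projection_le_of_linear_escape`). A geodesic escapes in both directions from its vertex closest to
`v`. This gives the bounded geodesic image property: geodesics from `a` to `b` pass within bounded
distance of `v` if `d_v(a, b) > 4θ`, and through `v` itself if `d_v(a, b)` is larger than a constant
`M` depending on `θ` and `K`. The former makes `X` hyperbolic (`thin_triangles`), since the walk above
is then close to each geodesic with the same end points and to the union of the other two sides of
each triangle.

The elements of the spinning groups `R_v` are thus rotations about vertices by angles much larger
than `M` (`IsRotatingFamily`). Fix a base point `x`. For each `v` and each `R_v`-orbit, one of the
positions at `v` is chosen, a position being the set of the first edges of geodesics from `v` to a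
point of the orbit. If all geodesics from `x` to `y` pass through `u` and then through `v`, then `y`
and `v` have the same position at `u`, so that choices at `u` are not affected by rotations about
`v`. Rotating a vertex `y` about the first vertex at which it is not in the chosen position lowers a
complexity (`complexity_lt_of_reduces`), the end result is unique in each orbit of the group `N`
generated by the `R_v` (`join_smul`), and it is `x` in the orbit of `x` (`reflTransGen_base`).

A geodesic triangle of `X/N` lifts to a path of three geodesics from `x` to a point `x'` of its
`N`-orbit. If `x' ≠ x`, the first reduction of `x'` rotates about a vertex `u` that is `x` itself or
has `d_u(x, x') > 3M`. One of the three geodesics passes through `u`, and the path can be bent there,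
which replaces `x'` by its reduction. So some lift closes up (`exists_closed_lift`), and it is thin.
-/

/-! ### The modified distance -/

section ModifiedDistance

variable {Y : Type*} {θ : ℝ} {d : Y → Y → Y → ℝ}

theorem mem_modifyingPairs_self {x z : Y} (hxz : x ≠ z) : (x, z) ∈ modifyingPairs θ d x z :=
  ⟨hxz, Or.inr (Or.inr (Or.inr rfl))⟩

namespace ProjectionAxioms

theorem swap_mem_modifyingPairs (h : ProjectionAxioms θ d) {x z : Y} (hxz : x ≠ z) {p : Y × Y}
    (hp : p ∈ modifyingPairs θ d x z) : p.swap ∈ modifyingPairs θ d z x := by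
  obtain ⟨a, b⟩ := p
  obtain ⟨hne, hp⟩ := hp
  refine ⟨hne.symm, ?_⟩
  rcases hp with ⟨h1, h2, h3, h4, h5, h6⟩ | ⟨h1, h2, h3⟩ | ⟨h1, h2, h3⟩ | h1
  · exact Or.inl ⟨h4, h3, h2, h1, by rw [Prod.fst_swap, Prod.snd_swap, h.symm z b a h4 h2]; exact h6,
      by rw [Prod.fst_swap, Prod.snd_swap, h.symm x b a h3 h1]; exact h5⟩
  · exact Or.inr (Or.inr (Or.inl ⟨h1, h2, by rw [Prod.fst_swap, h.symm z b x h2 hxz]; exact h3⟩))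
  · exact Or.inr (Or.inl ⟨h1, h2, by rw [Prod.snd_swap, h.symm x z a hxz.symm h2]; exact h3⟩)
  · obtain ⟨rfl, rfl⟩ := Prod.mk.inj h1
    exact Or.inr (Or.inr (Or.inr rfl))

theorem modifiedDist_bddBelow (h : ProjectionAxioms θ d) (y x z : Y) :
    BddBelow {r | ∃ p ∈ modifyingPairs θ d x z, p.1 ≠ y ∧ p.2 ≠ y ∧ r = d y p.1 p.2} :=
  ⟨0, by rintro r ⟨p, -, h1, h2, rfl⟩; exact h.nonneg _ _ _ h1 h2⟩

theorem modifiedDist_le (h : ProjectionAxioms θ d) {y x z : Y} (hxy : x ≠ y) (hzy : z ≠ y)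
    (hxz : x ≠ z) : modifiedDist θ d y x z ≤ d y x z :=
  csInf_le (h.modifiedDist_bddBelow y x z) ⟨(x, z), mem_modifyingPairs_self hxz, hxy, hzy, rfl⟩

/-- If `p` runs over pairs modifying `(x, z)`, and each of them modifies `(a, b)` up to order, then
the modified distances of `a` and `b` are at most those of `x` and `z`. -/
theorem modifiedDist_anti (h : ProjectionAxioms θ d) {y x z a b : Y} (hxy : x ≠ y) (hzy : z ≠ y)
    (hxz : x ≠ z) (H : ∀ p ∈ modifyingPairs θ d x z,
      p ∈ modifyingPairs θ d a b ∨ p.swap ∈ modifyingPairs θ d a b) :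
    modifiedDist θ d y a b ≤ modifiedDist θ d y x z := by
  refine le_csInf ⟨_, (x, z), mem_modifyingPairs_self hxz, hxy, hzy, rfl⟩ ?_
  rintro r ⟨p, hp, h1, h2, rfl⟩
  refine csInf_le (h.modifiedDist_bddBelow y a b) ?_
  rcases H p hp with hp | hp
  · exact ⟨p, hp, h1, h2, rfl⟩
  · exact ⟨p.swap, hp, h2, h1, h.symm _ _ _ h1 h2⟩

theorem modifiedDist_comm (h : ProjectionAxioms θ d) {y x z : Y} (hxy : x ≠ y) (hzy : z ≠ y)
    (hxz : x ≠ z) : modifiedDist θ d y x z = modifiedDist θ d y z x :=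
  le_antisymm
    (h.modifiedDist_anti hzy hxy hxz.symm fun _ hp => .inr (h.swap_mem_modifyingPairs hxz.symm hp))
    (h.modifiedDist_anti hxy hzy hxz fun _ hp => .inr (h.swap_mem_modifyingPairs hxz hp))

/-- A large projection of `x` and `z` to `y` makes the projection of `y` and `z` to `x` small. -/
theorem small_of_large (h : ProjectionAxioms θ d) {y x z : Y} (hxy : x ≠ y) (hzy : z ≠ y)
    (hxz : x ≠ z) (hl : θ < d y x z) : d x y z ≤ θ ∧ d z x y ≤ θ := by
  have h1 := h.triples x y z hxy hzy.symm hxz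
  have h2 := h.triples z y x hzy hxy.symm hxz.symm
  rw [h.symm y z x hzy hxy, h.symm x z y hxz.symm hxy.symm] at h2
  rcases min_le_iff.1 h1 with h1 | h1 <;> rcases min_le_iff.1 h2 with h2 | h2 <;>
    first | exact ⟨h2, h1⟩ | exact absurd hl (not_lt.2 ‹_›)

/-- Of two vertices of large projection at `x`, one is close to `x` from the point of view
of `y`. -/
theorem close_or_close (h : ProjectionAxioms θ d) {x y a b : Y} (hxy : x ≠ y) (hax : a ≠ x)
    (hbx : b ≠ x) (hay : a ≠ y) (hby : b ≠ y) (hl : 2 * θ < d x a b) :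
    d y x a ≤ θ ∨ d y x b ≤ θ := by
  by_contra! hc
  have h1 := (h.small_of_large hxy hay hax.symm hc.1).1
  have h2 := (h.small_of_large hxy hby hbx.symm hc.2).1
  have := h.triangle x a y b hax hxy.symm hbx
  rw [h.symm x a y hax hxy.symm] at this
  linarith

theorem le_modifiedDist (h : ProjectionAxioms θ d) {y x z : Y} (hxy : x ≠ y) (hzy : z ≠ y)
    (hxz : x ≠ z) : d y x z - 2 * θ ≤ modifiedDist θ d y x z := by
  have h0 := h.theta_nonneg
  refine le_csInf ⟨_, (x, z), mem_modifyingPairs_self hxz, hxy, hzy, rfl⟩ ?_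
  rintro r ⟨⟨a, b⟩, ⟨hne, hp⟩, hay, hby, rfl⟩
  dsimp only at hay hby hne hp ⊢
  have hab := h.nonneg y a b hay hby
  rcases hp with ⟨h1, h2, h3, h4, h5, h6⟩ | ⟨rfl, h2, h3⟩ | ⟨rfl, h2, h3⟩ | h1
  · have t1 := h.triangle y x a z hxy hay hzy
    have t2 := h.triangle y x b z hxy hby hzy
    have t3 := h.triangle y a b z hay hby hzy
    have t4 := h.triangle y b a z hby hay hzy
    have s1 := h.symm y z a hzy hay
    have s2 := h.symm y z b hzy hby
    have s3 := h.symm y a b hay hby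
    rcases h.close_or_close hxy h1 h3 hay hby h5 with c1 | c1 <;>
      rcases h.close_or_close hzy h2 h4 hay hby h6 with c2 | c2 <;> linarith
  · have t1 := h.triangle y a b z hay hby hzy
    have s2 := h.symm y z b hzy hby
    rcases h.close_or_close hzy hxz h2 hay hby h3 with c2 | c2
    · have := h.symm y z a hzy hay; linarith
    · linarith
  · have t1 := h.triangle y x a b hxy hay hby
    rcases h.close_or_close hxy h2 hxz.symm hay hby (by simpa using h3) with c2 | c2
    · linarith
    · linarith
  · obtain ⟨rfl, rfl⟩ := Prod.mk.inj h1
    linarith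

/-- Monotonicity of the modified distance: when `y` lies between `x` and `z`, the pairs modifying
`(x, z)` also modify `(x, y)`. -/
theorem modifiedDist_mono_left (h : ProjectionAxioms θ d) {w x y z : Y} (hxy : x ≠ y)
    (hzy : z ≠ y) (hxz : x ≠ z) (hxw : x ≠ w) (hzw : z ≠ w) (hl : 4 * θ < d y x z) :
    modifiedDist θ d w x y ≤ modifiedDist θ d w x z := by
  have h0 := h.theta_nonneg
  refine h.modifiedDist_anti hxw hzw hxz ?_
  have hs := h.small_of_large hxy hzy hxz (by linarith)
  rintro ⟨a, b⟩ hp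
  by_cases hay : a = y
  · subst hay
    obtain ⟨hne, hp⟩ := hp
    dsimp only at hne hp
    rcases hp with ⟨h1, h2, h3, h4, h5, h6⟩ | ⟨h1, h2, h3⟩ | ⟨h1, h2, h3⟩ | h1
    · exact .inr ⟨hne.symm, Or.inr (Or.inr (Or.inl ⟨rfl, h3, by
        rw [Prod.fst_swap, h.symm x b a h3 h1]; exact h5⟩))⟩
    · exact absurd h1 hxy.symm
    · subst h1
      linarith
    · exact absurd (Prod.mk.inj h1).1 hxy.symm
  by_cases hby : b = y
  · subst hby
    obtain ⟨hne, hp⟩ := hp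
    dsimp only at hne hp
    rcases hp with ⟨h1, h2, h3, h4, h5, h6⟩ | ⟨rfl, h2, h3⟩ | ⟨h1, h2, h3⟩ | h1
    · exact .inl ⟨hne, Or.inr (Or.inr (Or.inl ⟨rfl, h1, h5⟩))⟩
    · exact .inl (mem_modifyingPairs_self hxy)
    · exact absurd h1 hzy.symm
    · exact absurd (Prod.mk.inj h1).2 hzy.symm
  left
  have hlow : d y x z - 2 * θ ≤ d y a b :=
    (h.le_modifiedDist hxy hzy hxz).trans
      (csInf_le (h.modifiedDist_bddBelow y x z) ⟨(a, b), hp, hay, hby, rfl⟩)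
  obtain ⟨hne, hp⟩ := hp
  dsimp only at hne hp
  refine ⟨hne, ?_⟩
  rcases hp with ⟨h1, h2, h3, h4, h5, h6⟩ | ⟨rfl, h2, h3⟩ | ⟨rfl, h2, h3⟩ | h1
  · exact Or.inl ⟨h1, hay, h3, hby, h5, by linarith⟩
  · exact Or.inr (Or.inl ⟨rfl, hby, by linarith⟩)
  · exact Or.inl ⟨h2, hay, hxz.symm, hby, h3, by linarith⟩
  · obtain ⟨rfl, rfl⟩ := Prod.mk.inj h1
    exact Or.inr (Or.inl ⟨rfl, hby, by linarith⟩)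

theorem modifiedDist_mono_right (h : ProjectionAxioms θ d) {w x y z : Y} (hxy : x ≠ y)
    (hzy : z ≠ y) (hxz : x ≠ z) (hxw : x ≠ w) (hyw : y ≠ w) (hzw : z ≠ w) (hl : 4 * θ < d y x z) :
    modifiedDist θ d w y z ≤ modifiedDist θ d w x z := by
  rw [h.modifiedDist_comm hyw hzw hzy.symm, h.modifiedDist_comm hxw hzw hxz]
  rw [h.symm y x z hxy hzy] at hl
  exact h.modifiedDist_mono_left hzy hxy hxz.symm hzw hxw hl

end ProjectionAxioms

end ModifiedDistance

/-! ### Adjacency and connectedness of the projection complex -/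

section Complex

variable {Y : Type*} {θ : ℝ} {d : Y → Y → Y → ℝ} {K : ℝ}

namespace ProjectionAxioms

theorem adj_of_forall (h : ProjectionAxioms θ d) {x z : Y} (hxz : x ≠ z)
    (H : ∀ y, y ≠ x → y ≠ z → modifiedDist θ d y x z ≤ K) :
    (projectionComplex θ d K).Adj x z :=
  ⟨hxz, fun y hx hz => ⟨H y hx hz, by
    rw [h.modifiedDist_comm hz.symm hx.symm hxz.symm]; exact H y hx hz⟩⟩

theorem dist_le_of_adj (h : ProjectionAxioms θ d) {x z y : Y}
    (hxz : (projectionComplex θ d K).Adj x z) (hx : x ≠ y) (hz : z ≠ y) :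
    d y x z ≤ K + 2 * θ := by
  have := (hxz.2 y hx.symm hz.symm).1
  have := h.le_modifiedDist hx hz hxz.1
  linarith

/-- The vertices with modified projection of `x` and `z` larger than `K` are the interior vertices
of a walk from `x` to `z`: any of them splits the set into two smaller ones, by monotonicity. -/
theorem exists_walk (h : ProjectionAxioms θ d) (hK : 100 * θ + 100 ≤ K) {x z : Y} (hxz : x ≠ z) :
    ∃ p : (projectionComplex θ d K).Walk x z, ∀ u ∈ p.support,
      u = x ∨ u = z ∨ (x ≠ u ∧ z ≠ u ∧ K < modifiedDist θ d u x z) := by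
  have h0 := h.theta_nonneg
  have hfin : ∀ x z : Y, x ≠ z → {u | x ≠ u ∧ z ≠ u ∧ K < modifiedDist θ d u x z}.Finite := by
    intro x z hxz
    refine (h.finiteness x z).subset ?_
    rintro u ⟨h1, h2, h3⟩
    have := h.modifiedDist_le h1 h2 hxz
    exact ⟨h1, h2, by linarith⟩
  induction hn : {u | x ≠ u ∧ z ≠ u ∧ K < modifiedDist θ d u x z}.ncard
    using Nat.strong_induction_on generalizing x z with
  | _ n ih =>
  by_cases hadj : ∀ y, y ≠ x → y ≠ z → modifiedDist θ d y x z ≤ K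
  · refine ⟨.cons (h.adj_of_forall hxz hadj) .nil, ?_⟩
    intro u hu
    simp at hu
    tauto
  push Not at hadj
  obtain ⟨y, hyx, hyz, hy⟩ := hadj
  have hyl := h.modifiedDist_le hyx.symm hyz.symm hxz
  have hs := h.small_of_large hyx.symm hyz.symm hxz (by linarith)
  have sub1 : {u | x ≠ u ∧ y ≠ u ∧ K < modifiedDist θ d u x y} ⊂
      {u | x ≠ u ∧ z ≠ u ∧ K < modifiedDist θ d u x z} := by
    refine Set.ssubset_iff_of_subset ?_ |>.2 ⟨y, ⟨hyx.symm, hyz.symm, hy⟩, fun hc => hc.2.1 rfl⟩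
    rintro u ⟨h1, h2, h3⟩
    have h4 : z ≠ u := by
      rintro rfl
      have := h.modifiedDist_le h1 h2 hyx.symm
      linarith
    exact ⟨h1, h4, h3.trans_le
      (h.modifiedDist_mono_left hyx.symm hyz.symm hxz h1 h4 (by linarith))⟩
  have sub2 : {u | y ≠ u ∧ z ≠ u ∧ K < modifiedDist θ d u y z} ⊂
      {u | x ≠ u ∧ z ≠ u ∧ K < modifiedDist θ d u x z} := by
    refine Set.ssubset_iff_of_subset ?_ |>.2 ⟨y, ⟨hyx.symm, hyz.symm, hy⟩, fun hc => hc.1 rfl⟩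
    rintro u ⟨h1, h2, h3⟩
    have h4 : x ≠ u := by
      rintro rfl
      have := h.modifiedDist_le h1 h2 hyz
      linarith
    exact ⟨h4, h2, h3.trans_le
      (h.modifiedDist_mono_right hyx.symm hyz.symm hxz h4 h1 h2 (by linarith))⟩
  obtain ⟨p, hp⟩ := ih _ (hn ▸ Set.ncard_lt_ncard sub1 (hfin x z hxz)) hyx.symm rfl
  obtain ⟨q, hq⟩ := ih _ (hn ▸ Set.ncard_lt_ncard sub2 (hfin x z hxz)) hyz rfl
  refine ⟨p.append q, fun u hu => ?_⟩
  rw [SimpleGraph.Walk.mem_support_append_iff] at hu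
  rcases hu with hu | hu
  · rcases hp u hu with h1 | rfl | h1
    · exact .inl h1
    · exact .inr (.inr ⟨hyx.symm, hyz.symm, hy⟩)
    · exact .inr (.inr (sub1.1 h1))
  · rcases hq u hu with rfl | h1 | h1
    · exact .inr (.inr ⟨hyx.symm, hyz.symm, hy⟩)
    · exact .inr (.inl h1)
    · exact .inr (.inr (sub2.1 h1))

theorem preconnected (h : ProjectionAxioms θ d) (hK : 100 * θ + 100 ≤ K) :
    (projectionComplex θ d K).Preconnected := by
  intro x z
  by_cases hxz : x = z
  · exact hxz ▸ .refl _
  · exact ⟨(h.exists_walk hK hxz).choose⟩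

/-- An edge with a large projection to `u` spans a triangle with `u`. -/
theorem adj_of_large_edge (h : ProjectionAxioms θ d) (hK : 100 * θ + 100 ≤ K) {u a b : Y}
    (hab : (projectionComplex θ d K).Adj a b) (hau : a ≠ u) (hbu : b ≠ u) (hl : 4 * θ < d u a b) :
    (projectionComplex θ d K).Adj a u := by
  have h0 := h.theta_nonneg
  refine h.adj_of_forall hau fun w hwa hwu => ?_
  by_cases hwb : w = b
  · subst hwb
    have := (h.small_of_large hau hbu hab.1 (by linarith)).2
    have := h.modifiedDist_le hwa.symm hwu.symm hau
    linarith
  · exact (h.modifiedDist_mono_left hau hbu hab.1 hwa.symm (Ne.symm hwb) hl).trans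
      (hab.2 w hwa hwb).1

/-- Two vertices at distance at least two are separated by a neighbor of the first one. -/
theorem exists_barrier (h : ProjectionAxioms θ d) (hK : 100 * θ + 100 ≤ K) {v x : Y}
    (hvx : v ≠ x) (hadj : ¬ (projectionComplex θ d K).Adj v x) :
    ∃ u, (projectionComplex θ d K).Adj v u ∧ x ≠ u ∧ K < d u v x := by
  obtain ⟨p, hp⟩ := h.exists_walk hK hvx
  cases p with
  | nil => exact absurd rfl hvx
  | @cons _ u _ hu p =>
    have hux : u ≠ x := by rintro rfl; exact hadj hu
    rcases hp u (by simp) with h1 | h1 | ⟨h1, h2, h3⟩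
    · exact absurd h1.symm hu.1
    · exact absurd h1 hux
    · exact ⟨u, hu, h2, h3.trans_le (h.modifiedDist_le h1 h2 hvx)⟩

end ProjectionAxioms

end Complex

/-! ### Geodesics in the projection complex -/

section Geodesics

theorem SimpleGraph.Walk.dist_getVert_le {V : Type*} {X : SimpleGraph V} {a b : V} (p : X.Walk a b)
    {i j : ℕ} (hij : i ≤ j) : X.dist (p.getVert i) (p.getVert j) ≤ j - i := by
  have h1 := X.dist_le ((p.drop i).take (j - i))
  have h2 : ((p.drop i).take (j - i)).length ≤ j - i := by
    simp
  have h3 := h1.trans h2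
  rwa [SimpleGraph.Walk.drop_getVert, Nat.add_sub_cancel' hij] at h3

theorem IsGeodesicWalk.dist_getVert {V : Type*} {X : SimpleGraph V} (hX : X.Preconnected) {a b : V}
    {p : X.Walk a b} (hp : IsGeodesicWalk X p) {i j : ℕ} (hij : i ≤ j) (hj : j ≤ p.length) :
    X.dist (p.getVert i) (p.getVert j) = j - i := by
  refine le_antisymm (p.dist_getVert_le hij) ?_
  have h1 := p.dist_getVert_le (Nat.zero_le i)
  have h2 := p.dist_getVert_le hj
  rw [p.getVert_zero] at h1
  rw [p.getVert_length] at h2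
  have t1 := (hX a (p.getVert i)).dist_triangle_left b
  have t2 := (hX (p.getVert i) (p.getVert j)).dist_triangle_left b
  have : p.length = X.dist a b := hp
  omega

variable {Y : Type*} {θ : ℝ} {d : Y → Y → Y → ℝ} {K : ℝ}

namespace ProjectionAxioms

/-- A path that moves away from `v` at a linear rate has a bounded projection to `v`. A barrier `u`
between `v` and the origin of the path is next to `v`, so that the path, after four steps, moves
away from `u` at the same rate; by induction on its length its projection to `u` is bounded, and
hence the whole path stays behind `u`. -/
theorem projection_le_of_linear_escape (h : ProjectionAxioms θ d) (hK : 100 * θ + 100 ≤ K) (n : ℕ) :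
    ∀ (v : Y) (x : ℕ → Y), (∀ i < n, (projectionComplex θ d K).Adj (x i) (x (i + 1))) →
      (∀ i ≤ n, 12 + i ≤ 4 * (projectionComplex θ d K).dist v (x i)) →
      ∀ i ≤ n, d v (x 0) (x i) ≤ 2 * θ := by
  have h0 := h.theta_nonneg
  induction n using Nat.strong_induction_on with
  | _ n ih =>
  intro v x hx hv
  have hne : ∀ i ≤ n, x i ≠ v := by
    rintro i hi rfl
    have := hv i hi
    simp at this
  have hnadj : ¬ (projectionComplex θ d K).Adj v (x 0) := by
    intro hc
    have := hv 0 (Nat.zero_le _)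
    rw [SimpleGraph.dist_eq_one_iff_adj.2 hc] at this
    omega
  obtain ⟨u, hvu, -, hu⟩ := h.exists_barrier hK (hne 0 (Nat.zero_le _)).symm hnadj
  have huv : ∀ i ≤ n, 8 + i ≤ 4 * (projectionComplex θ d K).dist u (x i) := by
    intro i hi
    have h1 := hv i hi
    have h2 := (h.preconnected hK v u).dist_triangle_left (x i)
    rw [SimpleGraph.dist_eq_one_iff_adj.2 hvu] at h2
    omega
  have hneu : ∀ i ≤ n, x i ≠ u := by
    rintro i hi rfl
    have := huv i hi
    simp at this
  have hstep : ∀ i < n, d u (x (i + 1)) (x i) ≤ 4 * θ := by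
    intro i hi
    by_contra! hc
    have hadj := h.adj_of_large_edge hK (hx i hi).symm (hneu _ hi) (hneu _ hi.le) hc
    have := huv (i + 1) hi
    rw [SimpleGraph.dist_eq_one_iff_adj.2 hadj.symm] at this
    omega
  have hshort : ∀ i ≤ n, i ≤ 4 → K - 4 * θ * i ≤ d u v (x i) := by
    intro i
    induction i with
    | zero => intro _ _; simpa using hu.le
    | succ i ihi =>
      intro hi hi4
      have h1 := ihi (by omega) (by omega)
      have h2 := h.triangle u v (x (i + 1)) (x i) hvu.1 (hneu _ hi) (hneu _ (by omega))
      have h3 := hstep i hi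
      push_cast
      linarith
  have hlong : ∀ i ≤ n, θ < d u v (x i) := by
    intro i hi
    by_cases hi4 : i ≤ 4
    · have h1 := hshort i hi hi4
      have h2 : (i : ℝ) ≤ 4 := by exact_mod_cast hi4
      nlinarith
    · have h1 := hshort 4 (by omega) le_rfl
      have h2 := ih (n - 4) (by omega) u (fun j => x (j + 4))
        (fun j hj => by have := hx (j + 4) (by omega); rwa [add_right_comm] at this)
        (fun j hj => by have := huv (j + 4) (by omega); omega) (i - 4) (by omega)
      have h3 : i - 4 + 4 = i := by omega
      simp only [zero_add, h3] at h2
      have h4 := h.triangle u v (x i) (x 4) hvu.1 (hneu _ hi) (hneu _ (by omega))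
      rw [h.symm u (x i) (x 4) (hneu _ hi) (hneu _ (by omega))] at h4
      push_cast at h1
      linarith
  have hclose : ∀ i ≤ n, d v u (x i) ≤ θ := fun i hi =>
    (h.small_of_large hvu.1 (hneu _ hi) (hne i hi).symm (hlong i hi)).1
  intro i hi
  have h1 := h.triangle v (x 0) u (x i) (hne 0 (by omega)) hvu.1.symm (hne i hi)
  rw [h.symm v (x 0) u (hne 0 (by omega)) hvu.1.symm] at h1
  have h2 := hclose 0 (by omega)
  have h3 := hclose i hi
  linarith

/-- A geodesic avoiding `v` is cut into two geodesic rays at a vertex closest to `v`. -/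
theorem projection_le_of_forall_ray (h : ProjectionAxioms θ d) (hK : 100 * θ + 100 ≤ K) {a b v : Y}
    {p : (projectionComplex θ d K).Walk a b} (hp : IsGeodesicWalk _ p) (hv : v ∉ p.support) {C : ℝ}
    (H : ∀ (n : ℕ) (x : ℕ → Y), (∀ i < n, (projectionComplex θ d K).Adj (x i) (x (i + 1))) →
      (∀ i ≤ n, x i ∈ p.support) → (∀ i ≤ n, (projectionComplex θ d K).dist (x 0) (x i) = i) →
      (∀ i ≤ n, (projectionComplex θ d K).dist v (x 0) ≤ (projectionComplex θ d K).dist v (x i)) →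
      d v (x 0) (x n) ≤ C) : d v a b ≤ 2 * C := by
  obtain ⟨j, hj, hmin⟩ := Finset.exists_min_image (Finset.range (p.length + 1))
    (fun i => (projectionComplex θ d K).dist v (p.getVert i)) ⟨0, by simp⟩
  simp only [Finset.mem_range, Nat.lt_succ_iff] at hj hmin
  have hmem : ∀ i, p.getVert i ∈ p.support := p.getVert_mem_support
  have hX := h.preconnected (d := d) (K := K) hK
  have h1 := H (p.length - j) (fun i => p.getVert (j + i))
    (fun i hi => p.adj_getVert_succ (by omega)) (fun i hi => hmem _)
    (fun i hi => by
      have := hp.dist_getVert hX (i := j) (j := j + i) (by omega) (by omega)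
      simpa using this)
    (fun i hi => hmin _ (by omega))
  have h2 := H j (fun i => p.getVert (j - i))
    (fun i hi => by
      have := p.adj_getVert_succ (i := j - (i + 1)) (by omega)
      rw [show j - (i + 1) + 1 = j - i by omega] at this
      exact this.symm) (fun i hi => hmem _)
    (fun i hi => by
      have := hp.dist_getVert hX (i := j - i) (j := j) (by omega) (by omega)
      rw [SimpleGraph.dist_comm]
      simp only [Nat.sub_zero]
      omega)
    (fun i hi => hmin _ (by omega))
  have e1 : j + (p.length - j) = p.length := by omega
  simp only [add_zero, e1, SimpleGraph.Walk.getVert_length] at h1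
  simp only [Nat.sub_zero, Nat.sub_self, SimpleGraph.Walk.getVert_zero] at h2
  have ha : a ≠ v := by rintro rfl; exact hv p.start_mem_support
  have hb : b ≠ v := by rintro rfl; exact hv p.end_mem_support
  have hc : p.getVert j ≠ v := by intro hc; exact hv (hc ▸ hmem j)
  have h3 := h.triangle v a (p.getVert j) b ha hc hb
  rw [h.symm v a _ ha hc] at h3
  linarith

/-- Geodesics far from `v` have a projection to `v` bounded in terms of `θ` only. -/
theorem projection_le_of_far_geodesic (h : ProjectionAxioms θ d) (hK : 100 * θ + 100 ≤ K)
    {a b v : Y} {p : (projectionComplex θ d K).Walk a b} (hp : IsGeodesicWalk _ p)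
    (hv : ∀ w ∈ p.support, 6 ≤ (projectionComplex θ d K).dist v w) : d v a b ≤ 4 * θ := by
  have hX := h.preconnected (d := d) (K := K) hK
  refine (h.projection_le_of_forall_ray hK hp (C := 2 * θ) (fun hc => ?_) ?_).trans (by linarith)
  · have := hv v hc
    simp at this
  · intro n x hx hmem hdist hmin
    refine h.projection_le_of_linear_escape hK n v x hx (fun i hi => ?_) n le_rfl
    have h1 := hmin i hi
    have h2 := hdist i hi
    have h3 := (hX (x 0) v).dist_triangle_left (x i)
    have h4 := hv _ (hmem 0 (Nat.zero_le _))
    rw [SimpleGraph.dist_comm (u := x 0) (v := v)] at h3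
    omega

/-- The bounded geodesic image property: geodesics with a large projection to `v` pass through
`v`. -/
theorem projection_le_of_geodesic (h : ProjectionAxioms θ d) (hd : ∀ y x, d y x x = 0)
    (hK : 100 * θ + 100 ≤ K) {a b v : Y} {p : (projectionComplex θ d K).Walk a b}
    (hp : IsGeodesicWalk _ p) (hv : v ∉ p.support) :
    d v a b ≤ 2 * (8 * (K + 2 * θ) + 2 * θ) := by
  have hX := h.preconnected (d := d) (K := K) hK
  have h0 := h.theta_nonneg
  refine h.projection_le_of_forall_ray hK hp hv ?_
  intro n x hx hmem hdist hmin
  have hne : ∀ i ≤ n, x i ≠ v := by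
    rintro i hi rfl
    exact hv (hmem i hi)
  have htri : ∀ i ≤ n, i ≤ (projectionComplex θ d K).dist v (x 0) +
      (projectionComplex θ d K).dist v (x i) := by
    intro i hi
    have h3 := (hX (x 0) v).dist_triangle_left (x i)
    rw [SimpleGraph.dist_comm (u := x 0) (v := v)] at h3
    rwa [hdist i hi] at h3
  by_cases hD : 6 ≤ (projectionComplex θ d K).dist v (x 0)
  · have := h.projection_le_of_linear_escape hK n v x hx (fun i hi => by
      have h1 := hmin i hi
      have h2 := htri i hi
      omega) n le_rfl
    linarith
  · -- the first eight steps are estimated one by one, after them the path escapes from `v`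
    have hshort : ∀ i ≤ n, d v (x 0) (x i) ≤ i * (K + 2 * θ) := by
      intro i
      induction i with
      | zero => intro _; simp [hd]
      | succ i ihi =>
        intro hi
        have h1 := ihi (by omega)
        have h2 := h.triangle v (x 0) (x i) (x (i + 1)) (hne _ (by omega)) (hne _ (by omega))
          (hne _ hi)
        have h3 := h.dist_le_of_adj (hx i hi) (hne i (by omega)) (hne _ hi)
        push_cast
        linarith
    by_cases hn : n ≤ 8
    · have h1 := hshort n le_rfl
      have h2 : (n : ℝ) ≤ 8 := by exact_mod_cast hn
      nlinarith
    · have h1 := hshort 8 (by omega)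
      have h2 := h.projection_le_of_linear_escape hK (n - 8) v (fun j => x (j + 8))
        (fun j hj => by have := hx (j + 8) (by omega); rwa [add_right_comm] at this)
        (fun j hj => by have := htri (j + 8) (by omega); omega) (n - 8) le_rfl
      have h3 : n - 8 + 8 = n := by omega
      simp only [zero_add, h3] at h2
      have h4 := h.triangle v (x 0) (x 8) (x n) (hne _ (by omega)) (hne _ (by omega)) (hne _ le_rfl)
      push_cast at h1
      linarith

/-- If each vertex of a walk `s` is close to some term of the path `x`, and `x i` comes after a
term close to the origin and before a term close to the end, then `x i` is close to `s`. -/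
theorem _root_.SimpleGraph.exists_close_to_walk {V : Type*} {X : SimpleGraph V}
    (hX : X.Preconnected) {n i : ℕ} {x : ℕ → V}
    (hx : ∀ i j, i ≤ j → j ≤ n → X.dist (x i) (x j) = j - i) (hi : i ≤ n) {a b : V}
    (s : X.Walk a b) (hs : ∀ v ∈ s.support, ∃ j ≤ n, X.dist v (x j) ≤ 5)
    (ha : ∃ j ≤ i, X.dist a (x j) ≤ 5) (hb : ∃ j, i ≤ j ∧ j ≤ n ∧ X.dist b (x j) ≤ 5) :
    ∃ v ∈ s.support, X.dist (x i) v ≤ 16 := by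
  have key : ∀ (v w : V) (j k : ℕ), j ≤ i → i ≤ k → k ≤ n → X.dist v (x j) ≤ 5 →
      X.dist w (x k) ≤ 5 → X.dist v w ≤ 1 → X.dist (x i) v ≤ 16 := by
    intro v w j k hj hk hkn h1 h2 h3
    have t1 := (hX (x j) v).dist_triangle_left (x k)
    have t2 := (hX v w).dist_triangle_left (x k)
    have t3 := (hX (x i) (x j)).dist_triangle_left v
    have e1 := hx j k (hj.trans hk) hkn
    have e2 := hx j i hj hi
    rw [SimpleGraph.dist_comm] at e2
    rw [SimpleGraph.dist_comm] at h1
    omega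
  induction s with
  | nil =>
    obtain ⟨j, hj, h1⟩ := ha
    obtain ⟨k, hk, hkn, h2⟩ := hb
    exact ⟨_, by simp, key _ _ j k hj hk hkn h1 h2 (by simp)⟩
  | @cons a c b hac s ih =>
    obtain ⟨m, hm, h1⟩ := hs c (by simp)
    by_cases hmi : m ≤ i
    · obtain ⟨v, hv, h2⟩ := ih (fun v hv => hs v (by simp [hv])) ⟨m, hmi, h1⟩ hb
      exact ⟨v, by simp [hv], h2⟩
    · obtain ⟨j, hj, h2⟩ := ha
      exact ⟨a, by simp, key _ _ j m hj (by omega) hm h2 h1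
        (SimpleGraph.dist_eq_one_iff_adj.2 hac).le⟩

/-- The projection complex is hyperbolic: both a geodesic from `a` to `b` and the union of the other
two sides of a triangle pass close to each vertex with a large projection of `a` and `b`. -/
theorem thin_triangles (h : ProjectionAxioms θ d) (hK : 100 * θ + 100 ≤ K) {a b c : Y}
    (p : (projectionComplex θ d K).Walk a b) (q : (projectionComplex θ d K).Walk b c)
    (r : (projectionComplex θ d K).Walk c a) (hp : IsGeodesicWalk _ p) (hq : IsGeodesicWalk _ q)
    (hr : IsGeodesicWalk _ r) (u : Y) (hu : u ∈ p.support) :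
    ∃ v, (v ∈ q.support ∨ v ∈ r.support) ∧ (projectionComplex θ d K).dist u v ≤ 21 := by
  have hX := h.preconnected (d := d) (K := K) hK
  have h0 := h.theta_nonneg
  have hclose : ∀ {a b v : Y} (p : (projectionComplex θ d K).Walk a b), IsGeodesicWalk _ p →
      4 * θ < d v a b → ∃ w ∈ p.support, (projectionComplex θ d K).dist v w ≤ 5 := by
    intro a b v p hp hl
    by_contra! hc
    exact absurd hl (not_lt.2 (h.projection_le_of_far_geodesic hK hp
      fun w hw => hc w hw))
  by_cases hab : a = b
  · subst hab
    refine ⟨a, .inl q.start_mem_support, ?_⟩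
    obtain rfl : p = .nil := by
      exact SimpleGraph.Walk.eq_nil_iff_nil.2
        (SimpleGraph.Walk.length_eq_zero_iff.1 (hp.trans SimpleGraph.dist_self))
    simp at hu
    simp [hu]
  obtain ⟨s, hs⟩ := h.exists_walk hK hab
  obtain ⟨i, rfl, hi⟩ := SimpleGraph.Walk.mem_support_iff_exists_getVert.1 hu
  have hs1 : ∀ v ∈ s.support, ∃ j ≤ p.length,
      (projectionComplex θ d K).dist v (p.getVert j) ≤ 5 := by
    intro v hv
    suffices ∃ w ∈ p.support, (projectionComplex θ d K).dist v w ≤ 5 by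
      obtain ⟨w, hw, h1⟩ := this
      obtain ⟨j, rfl, hj⟩ := SimpleGraph.Walk.mem_support_iff_exists_getVert.1 hw
      exact ⟨j, hj, h1⟩
    rcases hs v hv with rfl | rfl | ⟨h1, h2, h3⟩
    · exact ⟨v, p.start_mem_support, by simp⟩
    · exact ⟨v, p.end_mem_support, by simp⟩
    · have := h.modifiedDist_le h1 h2 hab
      exact hclose p hp (by linarith)
  have hs2 : ∀ v ∈ s.support, ∃ w, (w ∈ q.support ∨ w ∈ r.support) ∧
      (projectionComplex θ d K).dist v w ≤ 5 := by
    intro v hv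
    rcases hs v hv with rfl | rfl | ⟨h1, h2, h3⟩
    · exact ⟨v, .inr r.end_mem_support, by simp⟩
    · exact ⟨v, .inl q.start_mem_support, by simp⟩
    · have := h.modifiedDist_le h1 h2 hab
      by_cases hcv : c = v
      · exact ⟨v, .inl (hcv ▸ q.end_mem_support), by simp⟩
      have h4 := h.triangle v a c b h1 hcv h2
      rw [h.symm v a c h1 hcv, h.symm v c b hcv h2] at h4
      by_cases h5 : 4 * θ < d v b c
      · obtain ⟨w, hw, h6⟩ := hclose q hq h5
        exact ⟨w, .inl hw, h6⟩
      · obtain ⟨w, hw, h6⟩ := hclose r hr (v := v) (by linarith)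
        exact ⟨w, .inr hw, h6⟩
  obtain ⟨v, hv, h1⟩ := SimpleGraph.exists_close_to_walk hX
    (fun i j hij hj => hp.dist_getVert hX hij hj) hi s hs1 ⟨0, Nat.zero_le _, by simp⟩
    ⟨p.length, hi, le_rfl, by simp⟩
  obtain ⟨w, hw, h2⟩ := hs2 v hv
  refine ⟨w, hw, ?_⟩
  have := (hX (p.getVert i) v).dist_triangle_left w
  omega

end ProjectionAxioms

end Geodesics

/-! ### Cut vertices of geodesics -/

section Cut

variable {Y : Type*} {X : SimpleGraph Y}

/-- The vertex `v` lies on all geodesics from `a` to `b`: it lies on one of them, and it is the only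
vertex at its distance from `a` that does. -/
def IsGeodesicCut (X : SimpleGraph Y) (v a b : Y) : Prop :=
  X.dist a v + X.dist v b = X.dist a b ∧
    ∀ w, X.dist a w = X.dist a v → X.dist a w + X.dist w b = X.dist a b → w = v

/-- The neighbors of `v` on geodesics from `v` to `y`. -/
def firstSteps (X : SimpleGraph Y) (v y : Y) : Set Y :=
  {a | X.Adj v a ∧ X.dist a y + 1 = X.dist v y}

namespace SimpleGraph.Preconnected

theorem exists_isGeodesicWalk (hX : X.Preconnected) (a b : Y) :
    ∃ p : X.Walk a b, IsGeodesicWalk X p :=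
  (hX a b).exists_walk_length_eq_dist

theorem exists_between (hX : X.Preconnected) (a b : Y) {k : ℕ} (hk : k ≤ X.dist a b) :
    ∃ w, X.dist a w = k ∧ X.dist a w + X.dist w b = X.dist a b := by
  obtain ⟨p, hp⟩ := hX.exists_isGeodesicWalk a b
  have hl : p.length = X.dist a b := hp
  have h1 := hp.dist_getVert hX (Nat.zero_le k) (by omega)
  have h2 := hp.dist_getVert hX (i := k) (j := p.length) (by omega) le_rfl
  rw [p.getVert_zero] at h1
  rw [p.getVert_length] at h2
  exact ⟨p.getVert k, by omega, by omega⟩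

theorem tri (hX : X.Preconnected) (a b c : Y) : X.dist a c ≤ X.dist a b + X.dist b c :=
  (hX a b).dist_triangle_left c

theorem firstSteps_nonempty (hX : X.Preconnected) {v y : Y} (hvy : v ≠ y) :
    (firstSteps X v y).Nonempty := by
  have hpos := (hX v y).pos_dist_of_ne hvy
  obtain ⟨w, h1, h2⟩ := hX.exists_between v y (k := 1) hpos
  exact ⟨w, SimpleGraph.dist_eq_one_iff_adj.1 h1, by omega⟩

theorem isGeodesicCut_self_left (hX : X.Preconnected) (a b : Y) : IsGeodesicCut X a a b := by
  refine ⟨by simp, fun w hw _ => ?_⟩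
  rw [SimpleGraph.dist_self] at hw
  exact ((hX a w).dist_eq_zero_iff.1 hw).symm

theorem mem_support_of_isGeodesicCut (hX : X.Preconnected) {v a b : Y} (hv : IsGeodesicCut X v a b)
    {p : X.Walk a b} (hp : IsGeodesicWalk X p) : v ∈ p.support := by
  have hl : p.length = X.dist a b := hp
  have h0 := hv.1
  have h1 := hp.dist_getVert hX (Nat.zero_le (X.dist a v)) (by omega)
  have h2 := hp.dist_getVert hX (i := X.dist a v) (j := p.length) (by omega) le_rfl
  rw [p.getVert_zero] at h1
  rw [p.getVert_length] at h2
  rw [← hv.2 (p.getVert (X.dist a v)) (by omega) (by omega)]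
  exact p.getVert_mem_support _

theorem exists_geodesic_avoiding (hX : X.Preconnected) {v a b : Y} (hv : ¬ IsGeodesicCut X v a b) :
    ∃ p : X.Walk a b, IsGeodesicWalk X p ∧ v ∉ p.support := by
  by_contra! hall
  have index : ∀ (p : X.Walk a b), IsGeodesicWalk X p → ∀ w ∈ p.support,
      w = p.getVert (X.dist a w) ∧ X.dist a w + X.dist w b = X.dist a b := by
    intro p hp w hw
    obtain ⟨i, rfl, hi⟩ := SimpleGraph.Walk.mem_support_iff_exists_getVert.1 hw
    have hl : p.length = X.dist a b := hp
    have h1 := hp.dist_getVert hX (Nat.zero_le i) hi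
    have h2 := hp.dist_getVert hX hi le_rfl
    rw [p.getVert_zero, Nat.sub_zero] at h1
    rw [p.getVert_length] at h2
    exact ⟨by rw [h1], by omega⟩
  obtain ⟨p, hp⟩ := hX.exists_isGeodesicWalk a b
  refine hv ⟨(index p hp v (hall p hp)).2, fun w hw1 hw2 => ?_⟩
  obtain ⟨p₁, hp₁⟩ := hX.exists_isGeodesicWalk a w
  obtain ⟨p₂, hp₂⟩ := hX.exists_isGeodesicWalk w b
  have hp₁₂ : IsGeodesicWalk X (p₁.append p₂) := by
    unfold IsGeodesicWalk at hp₁ hp₂ ⊢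
    rw [SimpleGraph.Walk.length_append, hp₁, hp₂, hw2]
  rw [(index _ hp₁₂ w (by simp)).1, (index _ hp₁₂ v (hall _ hp₁₂)).1, hw1]

theorem isGeodesicCut_of_le (hX : X.Preconnected) {x u w y : Y} (hw : IsGeodesicCut X w x y)
    (hu : X.dist x u + X.dist u y = X.dist x y) (hle : X.dist x w ≤ X.dist x u) :
    IsGeodesicCut X w x u := by
  have key : ∀ b, X.dist x b = X.dist x w → X.dist x b + X.dist b u = X.dist x u → b = w := by
    intro b h1 h2
    have t1 := hX.tri b u y
    have t2 := hX.tri x b y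
    exact hw.2 b h1 (by omega)
  obtain ⟨b, h1, h2⟩ := hX.exists_between x u hle
  obtain rfl := key b h1 h2
  exact ⟨h2, key⟩

theorem eq_of_between (hX : X.Preconnected) {x u v y : Y} (hv : IsGeodesicCut X v x y)
    (hu : X.dist x u + X.dist u y = X.dist x y) (hle : X.dist x u ≤ X.dist x v) :
    X.dist x u + X.dist u v = X.dist x v := by
  have h0 := hv.1
  obtain ⟨c, h1, h2⟩ := hX.exists_between u y (k := X.dist x v - X.dist x u) (by omega)
  have t1 := hX.tri x u c
  have t2 := hX.tri x c y
  obtain rfl := hv.2 c (by omega) (by omega)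
  omega

theorem isGeodesicCut_trans (hX : X.Preconnected) {x u v y : Y} (hu : IsGeodesicCut X u x v)
    (hv : IsGeodesicCut X v x y) : IsGeodesicCut X u x y := by
  have h1 := hu.1
  have h2 := hv.1
  have t1 := hX.tri u v y
  have t2 := hX.tri x u y
  refine ⟨by omega, fun b hb1 hb2 => ?_⟩
  exact hu.2 b hb1 (hX.eq_of_between hv hb2 (by omega))

/-- If all geodesics from `x` to `y` pass through `u` and later through `v`, then those from `u` to
`y` begin as those from `u` to `v` do. -/
theorem firstSteps_eq (hX : X.Preconnected) {x u v y : Y} (hu : IsGeodesicCut X u x v)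
    (hv : IsGeodesicCut X v x y) (huv : u ≠ v) : firstSteps X u y = firstSteps X u v := by
  have h1 := hu.1
  have h2 := hv.1
  have t1 := hX.tri u v y
  have t2 := hX.tri x u y
  have hpos := (hX u v).pos_dist_of_ne huv
  ext a
  simp only [firstSteps, Set.mem_ofPred_eq, and_congr_right_iff]
  intro hua
  have t3 := hX.tri x u a
  have t4 := hX.tri u a v
  have t5 := hX.tri x a y
  have t6 := hX.tri u a y
  have t7 := hX.tri a v y
  rw [SimpleGraph.dist_eq_one_iff_adj.2 hua] at t3 t4 t6
  constructor
  · intro ha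
    have := hX.eq_of_between hv (u := a) (by omega) (by omega)
    omega
  · intro ha
    omega

end SimpleGraph.Preconnected

end Cut

/-! ### Rotating families on graphs -/

section Rotating

/-- A family of groups `R v` of rotations of a connected graph `X` about its vertices. The angle
`e v a b` at `v` between `a` and `b` is at most `M` unless all geodesics from `a` to `b` pass
through `v`, and rotations turn every vertex that they move by an angle larger than `8M`. A
nontrivial rotation about `v` fixes no other vertices than leaves at `v`. -/
structure IsRotatingFamily {G Y : Type*} [Group G] [MulAction G Y] (X : SimpleGraph Y)
    (e : Y → Y → Y → ℝ) (M : ℝ) (R : Y → Subgroup G) : Prop where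
  preconnected : X.Preconnected
  adj_smul : ∀ (g : G) (a b : Y), X.Adj a b → X.Adj (g • a) (g • b)
  conj_mem : ∀ (g : G) (v : Y), ∀ h ∈ R v, g * h * g⁻¹ ∈ R (g • v)
  smul_eq : ∀ v, ∀ h ∈ R v, h • v = v
  nonneg : 0 ≤ M
  symm : ∀ v a b, a ≠ v → b ≠ v → e v a b = e v b a
  triangle : ∀ v a b c, a ≠ v → b ≠ v → c ≠ v → e v a c ≤ e v a b + e v b c
  angle_le : ∀ v a b, a ≠ v → b ≠ v → ¬ IsGeodesicCut X v a b → e v a b ≤ M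
  spinning : ∀ v, ∀ h ∈ R v, ∀ w, w ≠ v → h • w = w ∨ 8 * M < e v w (h • w)
  leaf : ∀ v, ∀ h ∈ R v, h ≠ 1 → ∀ w, w ≠ v → h • w = w → ∀ b, X.Adj w b → b = v

variable {G Y : Type*} [Group G] [MulAction G Y]

/-- The positions at `v` of the orbit of `y` under the rotations about `v`: a position is the set of
the first steps from `v`. -/
def positions (X : SimpleGraph Y) (R : Y → Subgroup G) (v y : Y) : Set (Set Y) :=
  {T | ∃ h ∈ R v, T = firstSteps X v (h • y)}

/-- A position at `v` that makes a small angle with the base point `x`. -/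
def IsSmallPosition (X : SimpleGraph Y) (e : Y → Y → Y → ℝ) (M : ℝ) (x v : Y) (T : Set Y) : Prop :=
  ∃ y, y ≠ v ∧ v ≠ x ∧ e v x y ≤ 3 * M ∧ T = firstSteps X v y

open Classical in
/-- A choice of one of the positions at `v` of the orbit of `y` under the rotations about `v`; a
position that makes a small angle with the base point `x` has priority. The choice depends only on
the set of positions. -/
noncomputable def chosenPosition (X : SimpleGraph Y) (e : Y → Y → Y → ℝ) (M : ℝ)
    (R : Y → Subgroup G) (x v y : Y) : Set Y :=
  Classical.epsilon fun T => T ∈ positions X R v y ∧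
    ((∃ T' ∈ positions X R v y, IsSmallPosition X e M x v T') → IsSmallPosition X e M x v T)

/-- The vertex `y` is not in the chosen position at `u ≠ y`. -/
def IsBad (X : SimpleGraph Y) (e : Y → Y → Y → ℝ) (M : ℝ) (R : Y → Subgroup G) (x u y : Y) : Prop :=
  u ≠ y ∧ firstSteps X u y ≠ chosenPosition X e M R x u y

/-- Among the vertices at which `y` is not in the chosen position, `u` is closest to `x`. -/
def IsFirstBad (X : SimpleGraph Y) (e : Y → Y → Y → ℝ) (M : ℝ) (R : Y → Subgroup G) (x u y : Y) :
    Prop :=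
  IsBad X e M R x u y ∧ ∀ w, IsBad X e M R x w y → X.dist x u ≤ X.dist x w

/-- The vertex `y'` arises from `y` by the rotation about the first bad vertex that brings `y` into
the chosen position there. -/
def Reduces (X : SimpleGraph Y) (e : Y → Y → Y → ℝ) (M : ℝ) (R : Y → Subgroup G) (x y y' : Y) :
    Prop :=
  ∃ u, IsFirstBad X e M R x u y ∧ ∃ t ∈ R u, y' = t • y ∧
    firstSteps X u y' = chosenPosition X e M R x u y

open Classical in
/-- The distances from `x` of the vertices other than `y` that are on all geodesics to `y`. -/
noncomputable def cutLevels (X : SimpleGraph Y) (x y : Y) : Finset ℕ :=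
  (Finset.range (X.dist x y)).filter fun k => ∃ u, X.dist x u = k ∧ IsGeodesicCut X u x y

open Classical in
/-- The distances from `x` beyond the first bad vertex of `y`. -/
noncomputable def badLevels (X : SimpleGraph Y) (e : Y → Y → Y → ℝ) (M : ℝ) (R : Y → Subgroup G)
    (x y : Y) : Finset ℕ :=
  (Finset.range (X.dist x y)).filter fun k => ∃ u, IsBad X e M R x u y ∧ X.dist x u ≤ k

/-- The complexity of a vertex, which reductions lower. -/
noncomputable def complexity (X : SimpleGraph Y) (e : Y → Y → Y → ℝ) (M : ℝ) (R : Y → Subgroup G)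
    (x y : Y) : ℕ ×ₗ ℕ ×ₗ ℕ :=
  toLex (X.dist x y, toLex ((cutLevels X x y).card, (badLevels X e M R x y).card))

namespace IsRotatingFamily

variable {X : SimpleGraph Y} {e : Y → Y → Y → ℝ} {M : ℝ} {R : Y → Subgroup G} {x : Y}

theorem dist_smul (hR : IsRotatingFamily X e M R) (g : G) (a b : Y) :
    X.dist (g • a) (g • b) = X.dist a b := by
  have key : ∀ (g : G) (a b : Y), X.dist (g • a) (g • b) ≤ X.dist a b := by
    intro g a b
    obtain ⟨p, hp⟩ := hR.preconnected.exists_isGeodesicWalk a b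
    have hp' : p.length = X.dist a b := hp
    let f : X →g X := ⟨fun y => g • y, fun h => hR.adj_smul g _ _ h⟩
    calc X.dist (g • a) (g • b) ≤ (p.map f).length := X.dist_le _
      _ = X.dist a b := by rw [SimpleGraph.Walk.length_map, hp']
  refine le_antisymm (key g a b) ?_
  simpa using key g⁻¹ (g • a) (g • b)

theorem adj_smul_iff (hR : IsRotatingFamily X e M R) (g : G) (a b : Y) :
    X.Adj (g • a) (g • b) ↔ X.Adj a b :=
  ⟨fun h => by simpa using hR.adj_smul g⁻¹ _ _ h, hR.adj_smul g a b⟩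

theorem ne_smul (hR : IsRotatingFamily X e M R) {v y : Y} {h : G} (hh : h ∈ R v) (hy : y ≠ v) :
    h • y ≠ v := by
  intro hc
  apply hy
  rw [← smul_left_cancel_iff h, hc, hR.smul_eq v h hh]

theorem smul_mem_firstSteps (hR : IsRotatingFamily X e M R) {v : Y} {h : G} (hh : h ∈ R v)
    (a y : Y) : h • a ∈ firstSteps X v (h • y) ↔ a ∈ firstSteps X v y := by
  have hv := hR.smul_eq v h hh
  have h1 := hR.adj_smul_iff h v a
  have h2 := hR.dist_smul h v y
  rw [hv] at h1 h2
  simp only [firstSteps, Set.mem_ofPred_eq, h1, h2, hR.dist_smul]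

theorem firstSteps_smul_congr (hR : IsRotatingFamily X e M R) {v : Y} {h : G} (hh : h ∈ R v)
    {y y' : Y} (hy : firstSteps X v y = firstSteps X v y') :
    firstSteps X v (h • y) = firstSteps X v (h • y') := by
  ext a
  have h1 := hR.smul_mem_firstSteps hh (h⁻¹ • a) y
  have h2 := hR.smul_mem_firstSteps hh (h⁻¹ • a) y'
  rw [smul_inv_smul] at h1 h2
  rw [h1, h2, hy]

theorem positions_congr (hR : IsRotatingFamily X e M R) {v y y' : Y}
    (hy : firstSteps X v y = firstSteps X v y') : positions X R v y = positions X R v y' := by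
  ext T
  constructor
  · rintro ⟨h, hh, rfl⟩
    exact ⟨h, hh, hR.firstSteps_smul_congr hh hy⟩
  · rintro ⟨h, hh, rfl⟩
    exact ⟨h, hh, (hR.firstSteps_smul_congr hh hy).symm⟩

theorem chosenPosition_congr (hR : IsRotatingFamily X e M R) {v y y' : Y}
    (hy : firstSteps X v y = firstSteps X v y') :
    chosenPosition X e M R x v y = chosenPosition X e M R x v y' := by
  unfold chosenPosition
  rw [hR.positions_congr hy]

theorem _root_.chosenPosition_smul {v : Y} {h : G} (hh : h ∈ R v) (y : Y) :
    chosenPosition X e M R x v (h • y) = chosenPosition X e M R x v y := by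
  have : positions X R v (h • y) = positions X R v y := by
    ext T
    constructor
    · rintro ⟨g, hg, rfl⟩
      exact ⟨g * h, mul_mem hg hh, by rw [mul_smul]⟩
    · rintro ⟨g, hg, rfl⟩
      exact ⟨g * h⁻¹, mul_mem hg (inv_mem hh), by rw [mul_smul, inv_smul_smul]⟩
  unfold chosenPosition
  rw [this]

theorem _root_.chosenPosition_spec (v y : Y) :
    chosenPosition X e M R x v y ∈ positions X R v y ∧
      ((∃ T ∈ positions X R v y, IsSmallPosition X e M x v T) →
        IsSmallPosition X e M x v (chosenPosition X e M R x v y)) := by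
  refine Classical.epsilon_spec (p := fun T => T ∈ positions X R v y ∧
    ((∃ T' ∈ positions X R v y, IsSmallPosition X e M x v T') → IsSmallPosition X e M x v T)) ?_
  by_cases h : ∃ T ∈ positions X R v y, IsSmallPosition X e M x v T
  · obtain ⟨T, hT, h1⟩ := h
    exact ⟨T, hT, fun _ => h1⟩
  · exact ⟨_, ⟨1, one_mem _, rfl⟩, fun h' => absurd h' h⟩

theorem angle_le_of_mem_firstSteps (hR : IsRotatingFamily X e M R) {v y a : Y} (hy : y ≠ v)
    (ha : a ∈ firstSteps X v y) : e v a y ≤ M := by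
  refine hR.angle_le v a y ha.1.ne' hy fun hc => ?_
  have h1 := hc.1
  have h2 := ha.2
  omega

/-- A rotation about `v` that leaves the position of `y` at `v` invariant fixes `y`: it fixes a first
step `a` from `v` to `y`, and if it is nontrivial, then `a` is a leaf at `v`, so that `y = a`. -/
theorem smul_eq_of_firstSteps_eq (hR : IsRotatingFamily X e M R) {v y : Y} {h : G} (hh : h ∈ R v)
    (hy : y ≠ v) (hs : firstSteps X v (h • y) = firstSteps X v y) : h • y = y := by
  have hX := hR.preconnected
  obtain ⟨a, ha⟩ := hX.firstSteps_nonempty hy.symm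
  have ha' : h • a ∈ firstSteps X v y := hs ▸ (hR.smul_mem_firstSteps hh a y).2 ha
  have h1 := hR.angle_le_of_mem_firstSteps hy ha
  have h2 := hR.angle_le_of_mem_firstSteps hy ha'
  have h3 := hR.triangle v a y (h • a) ha.1.ne' hy ha'.1.ne'
  rw [hR.symm v y _ hy ha'.1.ne'] at h3
  have hM := hR.nonneg
  rcases hR.spinning v h hh a ha.1.ne' with h4 | h4
  · by_cases h5 : h = 1
    · rw [h5, one_smul]
    · by_cases hay : a = y
      · rw [← hay, h4]
      · obtain ⟨b, hb⟩ := hX.firstSteps_nonempty hay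
        obtain rfl := hR.leaf v h hh h5 a ha.1.ne' h4 b hb.1
        have h6 := ha.2
        have h7 := hb.2
        omega
  · linarith

/-- Vertices that make a small angle with `x` are in the chosen position. -/
theorem chosenPosition_eq_of_angle_le (hR : IsRotatingFamily X e M R) {v y : Y} (hy : y ≠ v)
    (hvx : v ≠ x) (ha : e v x y ≤ 3 * M) :
    chosenPosition X e M R x v y = firstSteps X v y := by
  obtain ⟨⟨h, hh, h1⟩, h2⟩ := chosenPosition_spec (X := X) (e := e) (M := M) (R := R) (x := x) v y
  obtain ⟨y', hy', -, h3, h4⟩ := h2 ⟨_, ⟨1, one_mem _, rfl⟩,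
    ⟨y, hy, hvx, ha, by rw [one_smul]⟩⟩
  have hhy := hR.ne_smul hh hy
  rw [h1]
  rw [h1] at h4
  obtain ⟨a, ha1⟩ := hR.preconnected.firstSteps_nonempty hhy.symm
  have b1 := hR.angle_le_of_mem_firstSteps hhy ha1
  have b2 := hR.angle_le_of_mem_firstSteps hy' (h4 ▸ ha1)
  have hav := ha1.1.ne'
  have t1 := hR.triangle v y x (h • y) hy hvx.symm hhy
  have t2 := hR.triangle v x y' (h • y) hvx.symm hy' hhy
  have t3 := hR.triangle v y' a (h • y) hy' hav hhy
  rw [hR.symm v y x hy hvx.symm] at t1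
  rw [hR.symm v y' a hy' hav] at t3
  have hM := hR.nonneg
  rcases hR.spinning v h hh y hy with h5 | h5
  · rw [h5]
  · linarith

theorem large_angle_of_isBad (hR : IsRotatingFamily X e M R) {u y : Y}
    (hu : IsBad X e M R x u y) : u = x ∨ 3 * M < e u x y := by
  by_contra! hc
  exact hu.2 (hR.chosenPosition_eq_of_angle_le hu.1.symm hc.1 hc.2).symm

theorem isGeodesicCut_of_isBad (hR : IsRotatingFamily X e M R) {u y : Y}
    (hu : IsBad X e M R x u y) : IsGeodesicCut X u x y := by
  rcases hR.large_angle_of_isBad hu with h1 | h1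
  · exact h1 ▸ hR.preconnected.isGeodesicCut_self_left _ _
  · by_contra hc
    have hM := hR.nonneg
    by_cases hux : u = x
    · exact hc (hux ▸ hR.preconnected.isGeodesicCut_self_left _ _)
    have := hR.angle_le u x y (Ne.symm hux) hu.1.symm hc
    linarith

theorem not_isBad_base (hR : IsRotatingFamily X e M R) {u : Y} : ¬ IsBad X e M R x u x := by
  intro hu
  have h1 := (hR.isGeodesicCut_of_isBad hu).1
  rw [SimpleGraph.dist_self] at h1
  exact hu.1 ((hR.preconnected x u).dist_eq_zero_iff.1 (by omega)).symm

/-- If all geodesics from `x` to `y` pass through `u` and later through `v`, then `y` and `v` have the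
same position at `u`, so that `u` is bad for both of them or for neither. -/
theorem isBad_iff (hR : IsRotatingFamily X e M R) {u v y : Y} (hu : IsGeodesicCut X u x v)
    (hv : IsGeodesicCut X v x y) (huv : u ≠ v) :
    IsBad X e M R x u v ↔ IsBad X e M R x u y := by
  have h1 := hR.preconnected.firstSteps_eq hu hv huv
  have h2 := hR.chosenPosition_congr (x := x) h1
  have huy : u ≠ y := by
    rintro rfl
    have h3 := hu.1
    have h4 := hv.1
    rw [SimpleGraph.dist_comm (u := v) (v := u)] at h4
    exact huv ((hR.preconnected u v).dist_eq_zero_iff.1 (by omega))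
  unfold IsBad
  rw [h1, h2]
  simp [huv, huy]

theorem exists_isFirstBad (hu : ∃ u, IsBad X e M R x u y) :
    ∃ u, IsFirstBad X e M R x u y := by
  obtain ⟨u, h1, h2⟩ := (measure fun u => X.dist x u).wf.has_min {u | IsBad X e M R x u y} hu
  exact ⟨u, h1, fun w hw => not_lt.1 (h2 w hw)⟩

theorem exists_reduces {u y : Y} (hu : IsFirstBad X e M R x u y) :
    ∃ t ∈ R u, Reduces X e M R x y (t • y) := by
  obtain ⟨t, ht, h1⟩ := (chosenPosition_spec (X := X) (e := e) (M := M) (R := R) (x := x) u y).1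
  exact ⟨t, ht, u, hu, t, ht, rfl, h1.symm⟩

theorem isFirstBad_unique (hR : IsRotatingFamily X e M R) {u u' y : Y}
    (hu : IsFirstBad X e M R x u y) (hu' : IsFirstBad X e M R x u' y) : u = u' :=
  (hR.isGeodesicCut_of_isBad hu'.1).2 u (le_antisymm (hu.2 _ hu'.1) (hu'.2 _ hu.1))
    (hR.isGeodesicCut_of_isBad hu.1).1

theorem reduces_unique (hR : IsRotatingFamily X e M R) {y y₁ y₂ : Y}
    (h₁ : Reduces X e M R x y y₁) (h₂ : Reduces X e M R x y y₂) : y₁ = y₂ := by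
  obtain ⟨u, hu, t₁, ht₁, rfl, hs₁⟩ := h₁
  obtain ⟨u', hu', t₂, ht₂, rfl, hs₂⟩ := h₂
  obtain rfl := hR.isFirstBad_unique hu hu'
  have := hR.smul_eq_of_firstSteps_eq (h := t₂ * t₁⁻¹) (y := t₁ • y) (mul_mem ht₂ (inv_mem ht₁))
    (hR.ne_smul ht₁ hu.1.1.symm) (by rw [mul_smul, inv_smul_smul, hs₁, hs₂])
  rw [mul_smul, inv_smul_smul] at this
  exact this.symm

theorem dist_base_smul_le (hR : IsRotatingFamily X e M R) {u y : Y} {t : G} (ht : t ∈ R u)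
    (hu : IsGeodesicCut X u x y) : X.dist x (t • y) ≤ X.dist x y := by
  have h1 := hR.preconnected.tri x u (t • y)
  have h2 := hR.dist_smul t u y
  rw [hR.smul_eq u t ht] at h2
  have h3 := hu.1
  omega

/-- A rotation about a cut vertex `u` that does not lower the distance from `x` creates no new levels
of cut vertices. -/
theorem cutLevels_smul_subset (hR : IsRotatingFamily X e M R) {u y : Y} {t : G} (ht : t ∈ R u)
    (hu : IsGeodesicCut X u x y) (hd : X.dist x (t • y) = X.dist x y) :
    cutLevels X x (t • y) ⊆ cutLevels X x y := by
  have hX := hR.preconnected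
  have hty := hR.dist_smul t u y
  rw [hR.smul_eq u t ht] at hty
  have hu1 := hu.1
  intro k hk
  simp only [cutLevels, Finset.mem_filter, Finset.mem_range] at hk ⊢
  obtain ⟨hk, b, hbk, hb⟩ := hk
  refine ⟨hd ▸ hk, ?_⟩
  by_cases hle : k ≤ X.dist x u
  · exact ⟨b, hbk, hX.isGeodesicCut_trans (hX.isGeodesicCut_of_le hb (by omega) (by omega)) hu⟩
  · have key : ∀ c, X.dist x c = k → X.dist x c + X.dist c y = X.dist x y → c = t⁻¹ • b := by
      intro c hc1 hc2
      have h1 : X.dist x u + X.dist u c = X.dist x c := by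
        have h2 := hX.isGeodesicCut_of_le hu hc2 (by omega)
        exact h2.1
      have h3 := hR.dist_smul t u c
      rw [hR.smul_eq u t ht] at h3
      have h4 := hR.dist_smul t c y
      have t1 := hX.tri x u (t • c)
      have t2 := hX.tri x (t • c) (t • y)
      rw [← hb.2 (t • c) (by omega) (by omega), inv_smul_smul]
    obtain ⟨c, hc1, hc2⟩ := hX.exists_between x y (k := k) (by omega)
    refine ⟨c, hc1, hc2, fun w hw1 hw2 => ?_⟩
    rw [key w (by omega) hw2, key c hc1 hc2]

/-- Reductions lower the complexity. If neither the distance from `x` nor the number of cut vertices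
drops, then the vertex of the rotation remains a cut vertex, so that nothing changes before it, and
it is not bad any more. -/
theorem complexity_lt_of_reduces (hR : IsRotatingFamily X e M R) {y y' : Y}
    (h : Reduces X e M R x y y') : complexity X e M R x y' < complexity X e M R x y := by
  obtain ⟨u, hu, t, ht, rfl, hs⟩ := h
  have hX := hR.preconnected
  have hcut := hR.isGeodesicCut_of_isBad hu.1
  have hu1 := hcut.1
  have hpos := (hX u y).pos_dist_of_ne hu.1.1
  have hty := hR.dist_smul t u y
  rw [hR.smul_eq u t ht] at hty
  unfold complexity
  rw [Prod.Lex.toLex_lt_toLex, Prod.Lex.toLex_lt_toLex]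
  rcases (hR.dist_base_smul_le ht hcut).lt_or_eq with hd | hd
  · exact .inl hd
  refine .inr ⟨hd, ?_⟩
  have hsub := hR.cutLevels_smul_subset ht hcut hd
  rcases (Finset.card_le_card hsub).lt_or_eq with hc | hc
  · exact .inl hc
  refine .inr ⟨hc, ?_⟩
  have hcut' : IsGeodesicCut X u x (t • y) := by
    have h1 : X.dist x u ∈ cutLevels X x y := by
      simp only [cutLevels, Finset.mem_filter, Finset.mem_range]
      exact ⟨by omega, u, rfl, hcut⟩
    rw [← Finset.eq_of_subset_of_card_le hsub hc.ge] at h1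
    simp only [cutLevels, Finset.mem_filter, Finset.mem_range] at h1
    obtain ⟨-, w, hw1, hw2⟩ := h1
    rwa [hw2.2 u hw1.symm (by omega)]
  have hlate : ∀ w, IsBad X e M R x w (t • y) → X.dist x u < X.dist x w := by
    intro w hw
    by_contra! hle
    have hwcut := hR.isGeodesicCut_of_isBad hw
    have hwu := hX.isGeodesicCut_of_le hwcut hcut'.1 hle
    by_cases hne : w = u
    · subst hne
      exact hw.2 (hs.trans (chosenPosition_smul ht y).symm)
    · have h1 := (hR.isBad_iff hwu hcut hne).1 ((hR.isBad_iff hwu hcut' hne).2 hw)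
      have h2 := hu.2 w h1
      have h3 := hwu.1
      exact hne ((hX w u).dist_eq_zero_iff.1 (by omega))
  dsimp only
  apply Finset.card_lt_card
  refine Finset.ssubset_iff_of_subset ?_ |>.2 ⟨X.dist x u, ?_, ?_⟩
  · intro k hk
    simp only [badLevels, Finset.mem_filter, Finset.mem_range] at hk ⊢
    obtain ⟨hk, w, hw, hwk⟩ := hk
    exact ⟨hd ▸ hk, u, hu.1, (hlate w hw).le.trans hwk⟩
  · simp only [badLevels, Finset.mem_filter, Finset.mem_range]
    exact ⟨by omega, u, hu.1, le_rfl⟩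
  · simp only [badLevels, Finset.mem_filter, Finset.mem_range]
    rintro ⟨-, w, hw, hwk⟩
    exact absurd (hlate w hw) (not_lt.2 hwk)

theorem equivalence_join (hR : IsRotatingFamily X e M R) (x : Y) :
    Equivalence (Relation.Join (Relation.ReflTransGen (Reduces X e M R x))) :=
  Relation.equivalence_join_reflTransGen fun _ b _ hb hc =>
    ⟨b, .refl, by rw [hR.reduces_unique hb hc]⟩

/-- Behind a vertex `v` that is not itself reducible, the first bad vertex can only be `v`. -/
theorem isFirstBad_of_forall_not_isBad (hR : IsRotatingFamily X e M R) {v y : Y}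
    (hv : ∀ u, ¬ IsBad X e M R x u v) (hy : IsBad X e M R x v y) : IsFirstBad X e M R x v y := by
  refine ⟨hy, fun w hw => ?_⟩
  by_contra! hlt
  have hcut := hR.isGeodesicCut_of_isBad hy
  have hw1 := hR.preconnected.isGeodesicCut_of_le (hR.isGeodesicCut_of_isBad hw) hcut.1 hlt.le
  exact hv w ((hR.isBad_iff hw1 hcut (by rintro rfl; exact lt_irrefl _ hlt)).2 hw)

theorem exists_reflTransGen_chosenPosition (hR : IsRotatingFamily X e M R) {v : Y}
    (hv : ∀ u, ¬ IsBad X e M R x u v) (y : Y) (hy : v ≠ y) :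
    ∃ s ∈ R v, Relation.ReflTransGen (Reduces X e M R x) y (s • y) ∧
      firstSteps X v (s • y) = chosenPosition X e M R x v y := by
  by_cases hb : firstSteps X v y = chosenPosition X e M R x v y
  · exact ⟨1, one_mem _, by rw [one_smul], by rw [one_smul, hb]⟩
  · have hfirst := hR.isFirstBad_of_forall_not_isBad hv ⟨hy, hb⟩
    obtain ⟨t, ht, h1⟩ :=
      (chosenPosition_spec (X := X) (e := e) (M := M) (R := R) (x := x) v y).1
    exact ⟨t, ht, .single ⟨v, hfirst, t, ht, rfl, h1.symm⟩, h1.symm⟩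

/-- Vertices that differ by a rotation have a common reduction. If the center `v` of the rotation is
reducible, by a rotation `t` about `u`, say, then the rotation is a composition of rotations about
`u`, which is closer to `x` than `v`, and about `t • v`. -/
theorem join_smul (hR : IsRotatingFamily X e M R) (v : Y) : ∀ h ∈ R v, ∀ y,
    Relation.Join (Relation.ReflTransGen (Reduces X e M R x)) y (h • y) := by
  have hE := hR.equivalence_join x
  induction hc : complexity X e M R x v using WellFoundedLT.induction generalizing v with
  | ind c ih =>
  subst hc
  intro h hh y
  by_cases hv : ∃ u, IsBad X e M R x u v
  · obtain ⟨u, hu⟩ := exists_isFirstBad hv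
    obtain ⟨t, ht, hred⟩ := exists_reduces hu
    have hcut := hR.isGeodesicCut_of_isBad hu.1
    have hpos := (hR.preconnected u v).pos_dist_of_ne hu.1.1
    have hu1 := hcut.1
    have hlt : complexity X e M R x u < complexity X e M R x v := by
      unfold complexity
      rw [Prod.Lex.toLex_lt_toLex]
      exact .inl (by dsimp only; omega)
    have h1 := ih _ hlt u rfl t ht y
    have h2 := ih _ (hR.complexity_lt_of_reduces hred) (t • v) rfl _ (hR.conj_mem t v h hh) (t • y)
    have h3 := ih _ hlt u rfl t ht (h • y)
    rw [mul_smul, inv_smul_smul, mul_smul] at h2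
    exact hE.trans (hE.trans h1 h2) (hE.symm h3)
  · push Not at hv
    by_cases hvy : v = y
    · subst hvy
      rw [hR.smul_eq v h hh]
      exact hE.refl _
    · have hhy := hR.ne_smul hh (Ne.symm hvy)
      obtain ⟨s₁, hs₁, r₁, c₁⟩ := hR.exists_reflTransGen_chosenPosition hv y hvy
      obtain ⟨s₂, hs₂, r₂, c₂⟩ := hR.exists_reflTransGen_chosenPosition hv (h • y) hhy.symm
      rw [chosenPosition_smul hh] at c₂
      have h1 := hR.smul_eq_of_firstSteps_eq (h := s₂ * h * s₁⁻¹) (y := s₁ • y)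
        (mul_mem (mul_mem hs₂ hh) (inv_mem hs₁)) (hR.ne_smul hs₁ (Ne.symm hvy))
        (by rw [mul_smul, inv_smul_smul, mul_smul, c₁, c₂])
      rw [mul_smul, inv_smul_smul, mul_smul] at h1
      exact ⟨_, r₁, h1 ▸ r₂⟩

/-- Each vertex in the orbit of `x` under the group generated by the rotations reduces to `x`. -/
theorem reflTransGen_base (hR : IsRotatingFamily X e M R) {h : G} (hh : h ∈ ⨆ v, R v) :
    Relation.ReflTransGen (Reduces X e M R x) (h • x) x := by
  have hE := hR.equivalence_join x
  have key : ∀ y, Relation.Join (Relation.ReflTransGen (Reduces X e M R x)) y (h • y) := by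
    refine Subgroup.iSup_induction R (C := fun g => ∀ y,
      Relation.Join (Relation.ReflTransGen (Reduces X e M R x)) y (g • y)) hh
      (fun v g hg => hR.join_smul v g hg) (fun y => ?_) (fun g₁ g₂ h₁ h₂ y => ?_)
    · rw [one_smul]
      exact hE.refl y
    · rw [mul_smul]
      exact hE.trans (h₂ y) (h₁ _)
  obtain ⟨z, h1, h2⟩ := key x
  rcases Relation.ReflTransGen.cases_head h1 with rfl | ⟨w, ⟨u, hu, -⟩, -⟩
  · exact h2
  · exact absurd hu.1 hR.not_isBad_base

end IsRotatingFamily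

end Rotating

/-! ### Lifting walks from the quotient graph -/

section Quotient

variable {G Y : Type*} [Group G] [MulAction G Y] {X : SimpleGraph Y} {H : Subgroup G}

theorem mk_smul_of_mem {t : G} (ht : t ∈ H) (x : Y) :
    (Quotient.mk'' (t • x) : MulAction.orbitRel.Quotient H Y) = Quotient.mk'' x :=
  Quotient.sound' ⟨⟨t, ht⟩, rfl⟩

theorem SimpleGraph.Walk.exists_quotient_walk {a b : Y} (p : X.Walk a b) :
    ∃ q : (quotientGraph X H).Walk (Quotient.mk'' a) (Quotient.mk'' b), q.length ≤ p.length := by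
  induction p with
  | nil => exact ⟨.nil, le_rfl⟩
  | @cons a c b hac p ih =>
    obtain ⟨q, hq⟩ := ih
    by_cases h : (Quotient.mk'' a : MulAction.orbitRel.Quotient H Y) = Quotient.mk'' c
    · exact ⟨q.copy h.symm rfl, by simp; omega⟩
    · have hadj : (quotientGraph X H).Adj (Quotient.mk'' a) (Quotient.mk'' c) :=
        ⟨h, a, c, hac, rfl, rfl⟩
      exact ⟨.cons hadj q, by rw [SimpleGraph.Walk.length_cons, SimpleGraph.Walk.length_cons]; omega⟩

theorem SimpleGraph.Preconnected.quotientGraph (hX : X.Preconnected) :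
    (quotientGraph X H).Preconnected := by
  intro a b
  induction a using Quotient.inductionOn'
  induction b using Quotient.inductionOn'
  exact ⟨((hX _ _).some.exists_quotient_walk (H := H)).choose⟩

theorem SimpleGraph.Preconnected.quotientGraph_dist_le (hX : X.Preconnected) (a b : Y) :
    (_root_.quotientGraph X H).dist (Quotient.mk'' a) (Quotient.mk'' b) ≤ X.dist a b := by
  obtain ⟨p, hp⟩ := hX.exists_isGeodesicWalk a b
  obtain ⟨q, hq⟩ := p.exists_quotient_walk (H := H)
  exact ((SimpleGraph.dist_le q).trans hq).trans hp.le

/-- The walk `p` lifts the walk `p'` of the quotient graph. -/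
def IsLift {x y : Y} {a b : MulAction.orbitRel.Quotient H Y} (p : X.Walk x y)
    (p' : (quotientGraph X H).Walk a b) : Prop :=
  p.support.map Quotient.mk'' = p'.support

namespace IsLift

variable {x y : Y} {a b : MulAction.orbitRel.Quotient H Y} {p : X.Walk x y}
  {p' : (quotientGraph X H).Walk a b}

theorem mk_start (h : IsLift p p') : Quotient.mk'' x = a := by
  unfold IsLift at h
  rw [← p.cons_tail_support, ← p'.cons_tail_support, List.map_cons] at h
  exact (List.cons.inj h).1

theorem length_eq (h : IsLift p p') : p.length = p'.length := by
  have h1 := congrArg List.length h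
  simpa using h1

theorem mk_end (h : IsLift p p') : Quotient.mk'' y = b := by
  have h1 := congrArg List.getLast? h
  rw [List.getLast?_map, List.getLast?_eq_getLast_of_ne_nil p.support_ne_nil,
    List.getLast?_eq_getLast_of_ne_nil p'.support_ne_nil, p.getLast_support,
    p'.getLast_support] at h1
  exact Option.some.inj h1

/-- Lifts of geodesics are geodesics, as the quotient map does not increase distances. -/
theorem isGeodesicWalk (h : IsLift p p') (hX : X.Preconnected) (hp' : IsGeodesicWalk _ p') :
    IsGeodesicWalk X p := by
  have h1 := hX.quotientGraph_dist_le (H := H) x y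
  have h2 := X.dist_le p
  rw [h.mk_start, h.mk_end, ← hp'] at h1
  exact le_antisymm (h.length_eq.le.trans h1) h2

theorem smul (h : IsLift p p') (hX : ∀ (g : G) (a b : Y), X.Adj a b → X.Adj (g • a) (g • b))
    {t : G} (ht : t ∈ H) : ∃ q : X.Walk (t • x) (t • y), IsLift q p' := by
  let f : X →g X := ⟨fun y => t • y, fun h => hX t _ _ h⟩
  refine ⟨p.map f, ?_⟩
  unfold IsLift at h ⊢
  rw [← h, SimpleGraph.Walk.support_map, List.map_map]
  congr 1
  funext z
  exact mk_smul_of_mem ht z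

/-- A lift can be bent at any of its vertices by an element of the group fixing the vertex. -/
theorem bend (h : IsLift p p') (hX : ∀ (g : G) (a b : Y), X.Adj a b → X.Adj (g • a) (g • b))
    {t : G} (ht : t ∈ H) {u : Y} (hu : u ∈ p.support) (htu : t • u = u) :
    ∃ q : X.Walk x (t • y), IsLift q p' := by
  obtain ⟨p₁, p₂, rfl⟩ := SimpleGraph.Walk.mem_support_iff_exists_append.1 hu
  let f : X →g X := ⟨fun y => t • y, fun h => hX t _ _ h⟩
  refine ⟨p₁.append ((p₂.map f).copy htu rfl), ?_⟩
  unfold IsLift at h ⊢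
  rw [← h, SimpleGraph.Walk.support_append, SimpleGraph.Walk.support_append,
    SimpleGraph.Walk.support_copy, SimpleGraph.Walk.support_map, List.map_append, List.map_append,
    ← List.map_tail, List.map_map]
  congr 2
  funext z
  exact mk_smul_of_mem ht z

end IsLift

theorem exists_isLift (hX : ∀ (g : G) (a b : Y), X.Adj a b → X.Adj (g • a) (g • b))
    {a b : MulAction.orbitRel.Quotient H Y} (p' : (quotientGraph X H).Walk a b) :
    ∀ x : Y, Quotient.mk'' x = a → ∃ (y : Y) (p : X.Walk x y), IsLift p p' := by
  induction p' with
  | @nil a =>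
    intro x hx
    refine ⟨x, .nil, ?_⟩
    unfold IsLift
    simp [hx]
  | @cons a c b hac p' ih =>
    intro x hx
    obtain ⟨x₁, y₁, hadj, hx₁, hy₁⟩ := hac.2
    obtain ⟨g, rfl⟩ : x ∈ MulAction.orbit H x₁ := Quotient.exact' (hx.trans hx₁.symm)
    obtain ⟨y, p, hp⟩ := ih ((g : G) • y₁)
      ((mk_smul_of_mem g.2 y₁).trans hy₁)
    refine ⟨y, .cons (hX g _ _ hadj) p, ?_⟩
    unfold IsLift at hp ⊢
    rw [SimpleGraph.Walk.support_cons, SimpleGraph.Walk.support_cons, List.map_cons, hp]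
    exact congrArg (· :: _) hx

namespace IsRotatingFamily

variable {e : Y → Y → Y → ℝ} {M : ℝ} {R : Y → Subgroup G}

/-- A geodesic triangle of the quotient graph has a lift that closes up. Each reduction of the end
point of a lift to its starting point rotates about a vertex that lies on one of the sides, by the
bounded geodesic image property, so that the lift can be bent there. -/
theorem exists_closed_lift (hR : IsRotatingFamily X e M R)
    {a b c : MulAction.orbitRel.Quotient (⨆ v, R v : Subgroup G) Y}
    {p' : (quotientGraph X (⨆ v, R v : Subgroup G)).Walk a b}
    {q' : (quotientGraph X (⨆ v, R v : Subgroup G)).Walk b c}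
    {r' : (quotientGraph X (⨆ v, R v : Subgroup G)).Walk c a} (hp' : IsGeodesicWalk _ p')
    (hq' : IsGeodesicWalk _ q') (hr' : IsGeodesicWalk _ r') :
    ∃ (x y z : Y) (p : X.Walk x y) (q : X.Walk y z) (r : X.Walk z x),
      IsLift p p' ∧ IsLift q q' ∧ IsLift r r' := by
  have hX := hR.preconnected
  have hadj := hR.adj_smul
  obtain ⟨x, hx⟩ := Quotient.exists_rep a
  obtain ⟨y, p, hp⟩ := exists_isLift hadj p' x hx
  obtain ⟨z, q, hq⟩ := exists_isLift hadj q' y hp.mk_end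
  obtain ⟨x', r, hr⟩ := exists_isLift hadj r' z hq.mk_end
  obtain ⟨h, rfl⟩ : x' ∈ MulAction.orbit (⨆ v, R v : Subgroup G) x :=
    Quotient.exact' (hr.mk_end.trans hx.symm)
  have hred := hR.reflTransGen_base (x := x) h.2
  suffices H : ∀ x', Relation.ReflTransGen (Reduces X e M R x) x' x → ∀ (y z : Y) (p : X.Walk x y)
      (q : X.Walk y z) (r : X.Walk z x'), IsLift p p' → IsLift q q' → IsLift r r' →
      ∃ (y z : Y) (p : X.Walk x y) (q : X.Walk y z) (r : X.Walk z x),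
        IsLift p p' ∧ IsLift q q' ∧ IsLift r r' from
    ⟨x, H _ hred y z p q r hp hq hr⟩
  clear hred hp hq hr p q r y z
  intro x' hred
  induction hred using Relation.ReflTransGen.head_induction_on with
  | refl => exact fun y z p q r hp hq hr => ⟨y, z, p, q, r, hp, hq, hr⟩
  | @head x' x'' hstep _ ih =>
    intro y z p q r hp hq hr
    obtain ⟨u, hu, t, ht, rfl, -⟩ := hstep
    have htH : t ∈ ⨆ v, R v := (le_iSup R u) ht
    have htu := hR.smul_eq u t ht
    have hangle : ∀ {a b : Y} {s : X.Walk a b}, IsGeodesicWalk X s → u ∉ s.support →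
        a ≠ u ∧ b ≠ u ∧ e u a b ≤ M := by
      intro a b s hs hus
      have ha : a ≠ u := by rintro rfl; exact hus s.start_mem_support
      have hb : b ≠ u := by rintro rfl; exact hus s.end_mem_support
      exact ⟨ha, hb, hR.angle_le u a b ha hb fun hc => hus (hX.mem_support_of_isGeodesicCut hc hs)⟩
    by_cases hup : u ∈ p.support
    · obtain ⟨p₁, hp₁⟩ := hp.bend hadj htH hup htu
      obtain ⟨q₁, hq₁⟩ := hq.smul hadj htH
      obtain ⟨r₁, hr₁⟩ := hr.smul hadj htH
      exact ih _ _ _ _ _ hp₁ hq₁ hr₁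
    by_cases huq : u ∈ q.support
    · obtain ⟨q₁, hq₁⟩ := hq.bend hadj htH huq htu
      obtain ⟨r₁, hr₁⟩ := hr.smul hadj htH
      exact ih _ _ _ _ _ hp hq₁ hr₁
    by_cases hur : u ∈ r.support
    · obtain ⟨r₁, hr₁⟩ := hr.bend hadj htH hur htu
      exact ih _ _ _ _ _ hp hq hr₁
    obtain ⟨h1, h2, h3⟩ := hangle (hp.isGeodesicWalk hX hp') hup
    obtain ⟨-, h4, h5⟩ := hangle (hq.isGeodesicWalk hX hq') huq
    obtain ⟨-, h6, h7⟩ := hangle (hr.isGeodesicWalk hX hr') hur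
    rcases hR.large_angle_of_isBad hu.1 with h8 | h8
    · exact absurd h8.symm h1
    · have t1 := hR.triangle u x y x' h1 h2 h6
      have t2 := hR.triangle u y z x' h2 h4 h6
      linarith

end IsRotatingFamily

end Quotient

/-! ### Spinning families on the projection complex -/

section Spinning

variable {Y : Type*} {θ : ℝ} {d : Y → Y → Y → ℝ} {K : ℝ}

open Classical in
/-- The projection distances with the values on the diagonal replaced by `0`. The axioms do not bound
`d y x x`, which plays no role in the projection complex. -/
noncomputable def offDiagonal (d : Y → Y → Y → ℝ) (y x z : Y) : ℝ := if x = z then 0 else d y x z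

theorem offDiagonal_self (y x : Y) : offDiagonal d y x x = 0 := if_pos rfl

theorem offDiagonal_of_ne {x z : Y} (hxz : x ≠ z) (y : Y) : offDiagonal d y x z = d y x z :=
  if_neg hxz

theorem modifyingPairs_offDiagonal (x z : Y) :
    modifyingPairs θ (offDiagonal d) x z = modifyingPairs θ d x z := by
  ext ⟨a, b⟩
  simp only [modifyingPairs, Set.mem_ofPred_eq, and_congr_right_iff]
  intro hab
  simp only [offDiagonal_of_ne hab]
  refine or_congr_right (or_congr ?_ (or_congr_left ?_))
  · refine and_congr_right fun h => ?_
    subst h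
    rw [offDiagonal_of_ne hab]
  · refine and_congr_right fun h => ?_
    subst h
    rw [offDiagonal_of_ne hab]

theorem modifiedDist_offDiagonal (y x z : Y) :
    modifiedDist θ (offDiagonal d) y x z = modifiedDist θ d y x z := by
  unfold modifiedDist
  rw [modifyingPairs_offDiagonal]
  congr 1
  ext r
  refine exists_congr fun p => and_congr_right fun hp => ?_
  rw [offDiagonal_of_ne hp.1]

theorem projectionComplex_offDiagonal :
    projectionComplex θ (offDiagonal d) K = projectionComplex θ d K := by
  ext x z
  simp only [projectionComplex, modifiedDist_offDiagonal]

namespace ProjectionAxioms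

theorem offDiagonal (h : ProjectionAxioms θ d) : ProjectionAxioms θ (offDiagonal d) where
  theta_nonneg := h.theta_nonneg
  nonneg y x z hx hz := by
    unfold _root_.offDiagonal
    split_ifs
    · exact le_rfl
    · exact h.nonneg y x z hx hz
  symm y x z hx hz := by
    by_cases hxz : x = z
    · rw [hxz]
    · rw [offDiagonal_of_ne hxz, offDiagonal_of_ne (Ne.symm hxz), h.symm y x z hx hz]
  triangle y x z w hx hz hw := by
    have hnonneg : ∀ a b, a ≠ y → b ≠ y → 0 ≤ _root_.offDiagonal d y a b := by
      intro a b ha hb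
      unfold _root_.offDiagonal
      split_ifs
      · exact le_rfl
      · exact h.nonneg y a b ha hb
    by_cases hxw : x = w
    · subst hxw
      rw [offDiagonal_self]
      exact add_nonneg (hnonneg x z hx hz) (hnonneg z x hz hx)
    by_cases hxz : x = z
    · subst hxz
      rw [offDiagonal_self, zero_add]
    by_cases hzw : z = w
    · subst hzw
      rw [offDiagonal_self, add_zero]
    rw [offDiagonal_of_ne hxw, offDiagonal_of_ne hxz, offDiagonal_of_ne hzw]
    exact h.triangle y x z w hx hz hw
  triples x y z hxy hyz hxz := by
    rw [offDiagonal_of_ne hxz, offDiagonal_of_ne hxy]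
    exact h.triples x y z hxy hyz hxz
  finiteness x z := by
    refine (h.finiteness x z).subset ?_
    rintro y ⟨hx, hz, hl⟩
    by_cases hxz : x = z
    · subst hxz
      rw [offDiagonal_self] at hl
      exact absurd h.theta_nonneg (not_le.2 hl)
    · rw [offDiagonal_of_ne hxz] at hl
      exact ⟨hx, hz, hl⟩

end ProjectionAxioms

namespace ActsOnProjectionComplex

variable {G : Type*} [Group G] [MulAction G Y]

theorem smul_mem_modifyingPairs (hG : ActsOnProjectionComplex G d) (g : G) {x z : Y} (hxz : x ≠ z)
    {p : Y × Y} (hp : p ∈ modifyingPairs θ d x z) :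
    (g • p.1, g • p.2) ∈ modifyingPairs θ d (g • x) (g • z) := by
  obtain ⟨a, b⟩ := p
  obtain ⟨hne, hp⟩ := hp
  have hinj : ∀ {a b : Y}, a ≠ b → g • a ≠ g • b := fun h h' => h (smul_left_cancel g h')
  refine ⟨hinj hne, ?_⟩
  dsimp only at hp ⊢
  rcases hp with ⟨h1, h2, h3, h4, h5, h6⟩ | ⟨h1, h2, h3⟩ | ⟨h1, h2, h3⟩ | h1
  · exact Or.inl ⟨hinj h1, hinj h2, hinj h3, hinj h4, by rwa [hG g x a b h1 h3],
      by rwa [hG g z a b h2 h4]⟩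
  · exact Or.inr (Or.inl ⟨by rw [h1], hinj h2, by rwa [hG g z x b hxz h2]⟩)
  · exact Or.inr (Or.inr (Or.inl ⟨by rw [h1], hinj h2, by rwa [hG g x a z h2 hxz.symm]⟩))
  · obtain ⟨rfl, rfl⟩ := Prod.mk.inj h1
    exact Or.inr (Or.inr (Or.inr rfl))

theorem modifiedDist_smul (hG : ActsOnProjectionComplex G d) (g : G) (y : Y) {x z : Y}
    (hxz : x ≠ z) : modifiedDist θ d (g • y) (g • x) (g • z) = modifiedDist θ d y x z := by
  unfold modifiedDist
  congr 1
  ext r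
  constructor
  · rintro ⟨p, hp, h1, h2, rfl⟩
    have h3 := hG.smul_mem_modifyingPairs g⁻¹ (fun h => hxz (smul_left_cancel g h)) hp
    have h4 := hG g⁻¹ (g • y) p.1 p.2 h1 h2
    simp only [inv_smul_smul] at h3 h4
    refine ⟨_, h3, ?_, ?_, h4.symm⟩
    · rintro rfl; exact h1 (smul_inv_smul g p.1).symm
    · rintro rfl; exact h2 (smul_inv_smul g p.2).symm
  · rintro ⟨p, hp, h1, h2, rfl⟩
    exact ⟨_, hG.smul_mem_modifyingPairs g hxz hp, fun h => h1 (smul_left_cancel g h),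
      fun h => h2 (smul_left_cancel g h), (hG g y p.1 p.2 h1 h2).symm⟩

theorem adj_smul (hG : ActsOnProjectionComplex G d) (g : G) (a b : Y)
    (hab : (projectionComplex θ d K).Adj a b) :
    (projectionComplex θ d K).Adj (g • a) (g • b) := by
  refine ⟨fun h => hab.1 (smul_left_cancel g h), fun y hya hyb => ?_⟩
  have h1 := hab.2 (g⁻¹ • y) (fun h => hya (by rw [← h, smul_inv_smul]))
    (fun h => hyb (by rw [← h, smul_inv_smul]))
  rw [← hG.modifiedDist_smul g _ hab.1, ← hG.modifiedDist_smul g _ hab.1.symm, smul_inv_smul] at h1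
  exact h1

end ActsOnProjectionComplex

/-- A spinning family whose constant is large relative to `K` consists of rotations of the projection
complex. -/
theorem IsEquivariantSpinningFamily.isRotatingFamily {G : Type*} [Group G] [MulAction G Y] {L : ℝ}
    {R : Y → Subgroup G} (hR : IsEquivariantSpinningFamily d L R) (h : ProjectionAxioms θ d)
    (hG : ActsOnProjectionComplex G d) (hK : 100 * θ + 100 ≤ K)
    (hL : 8 * (2 * (8 * (K + 2 * θ) + 2 * θ)) + 2 * (K + 2 * θ) + 1 ≤ L) :
    IsRotatingFamily (projectionComplex θ d K) (offDiagonal d) (2 * (8 * (K + 2 * θ) + 2 * θ))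
      R := by
  have h0 := h.theta_nonneg
  have hX := h.preconnected hK
  exact {
    preconnected := hX
    adj_smul := hG.adj_smul
    conj_mem := fun g v t ht => by
      rw [← hR.equivariance g v]
      exact ⟨t, ht, by simp⟩
    smul_eq := fun v t ht => hR.le_stabilizer v ht
    nonneg := by linarith
    symm := h.offDiagonal.symm
    triangle := fun v a b c => h.offDiagonal.triangle v a b c
    angle_le := fun v a b ha hb hcut => by
      have := hX.exists_geodesic_avoiding hcut
      rw [← projectionComplex_offDiagonal] at this
      obtain ⟨p, hp, hv⟩ := this
      exact h.offDiagonal.projection_le_of_geodesic offDiagonal_self hK hp hv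
    spinning := fun v t ht w hw => by
      by_cases htw : t • w = w
      · exact .inl htw
      · right
        have h1 : t ≠ 1 := by rintro rfl; exact htw (one_smul _ _)
        rw [offDiagonal_of_ne (Ne.symm htw)]
        have := hR.spinning v w hw.symm t ht h1
        linarith
    leaf := fun v t ht h1 w hw htw b hb => by
      by_contra hbv
      have h2 := hR.spinning v w hw.symm t ht h1
      rw [htw] at h2
      have h3 := h.triangle v w b w hw hbv hw
      rw [h.symm v b w hbv hw] at h3
      have h4 := h.dist_le_of_adj hb hw hbv
      linarith }

end Spinning

theorem theorem1p1 :
    -- `K` is large enough relative to `θ`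
    ∃ K₀ : ℝ → ℝ, ∀ (Y : Type*) (θ : ℝ) (d : Y → Y → Y → ℝ), ProjectionAxioms θ d →
      ∀ K : ℝ, K₀ θ ≤ K →
        -- the constants depend on the projection complex only, not on the group
        ∃ Lhyp δ : ℝ, ∀ (G : Type*) [Group G] [MulAction G Y], ActsOnProjectionComplex G d →
          ∀ (L : ℝ) (R : Y → Subgroup G), Lhyp ≤ L → IsEquivariantSpinningFamily d L R →
            IsHyperbolicGraph
              (quotientGraph (projectionComplex θ d K) (⨆ v, R v : Subgroup G)) δ := by
  refine ⟨fun θ => 100 * θ + 100, fun Y θ d h K hK =>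
    ⟨8 * (2 * (8 * (K + 2 * θ) + 2 * θ)) + 2 * (K + 2 * θ) + 1, 21, ?_⟩⟩
  intro G _ _ hG L R hL hR
  have hrot := hR.isRotatingFamily h hG hK hL
  have hX := hrot.preconnected
  refine ⟨hX.quotientGraph, ?_⟩
  intro a b c p' q' r' hp' hq' hr' u hu
  obtain ⟨x, y, z, p, q, r, hp, hq, hr⟩ := hrot.exists_closed_lift hp' hq' hr'
  rw [← hp, List.mem_map] at hu
  obtain ⟨u, hu, rfl⟩ := hu
  obtain ⟨v, hv, hd⟩ := h.thin_triangles hK p q r (hp.isGeodesicWalk hX hp')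
    (hq.isGeodesicWalk hX hq') (hr.isGeodesicWalk hX hr') u hu
  refine ⟨Quotient.mk'' v, ?_, ?_⟩
  · rw [← hq, ← hr]
    exact hv.imp (List.mem_map_of_mem) (List.mem_map_of_mem)
  · exact_mod_cast (hX.quotientGraph_dist_le u v).trans hd
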